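/- Let $N\ge 1$. On $\mathbb R^{2N-1}$ with coordinates $(a_1,\dots,a_{N-1},b_1,\dots,b_N)$ (and the convention $a_0=a_N=0$) consider the finite nonperiodic Toda lattice $$\dot a_i=a_i(b_{i+1}-b_i),\qquad \dot b_i=2(a_i^2-a_{i-1}^2).$$ Let $L$ be the symmetric tridiagonal matrix with diagonal $b_1,\dots,b_N$ and off-diagonal entries $a_1,\dots,a_{N-1}$, let $H_l=\frac1l\operatorname{tr}L^l$ for $l\ge1$, let $\pi_1$ be the Poisson bracket with $\{a_i,b_i\}=-a_i$, $\{a_i,b_{i+1}\}=a_i$ and all other brackets of coordinates zero, and let $\chi_l$ be the Hamiltonian vector field of $H_l$ with respect to $\pi_1$, $\chi_l(f)=\{f,H_l\}$; thus $\chi_2$ is the vector field of the Toda lattice. Define vector fields $X_n$, $n\ge-1$, by $$X_{-1}=\sum_{i=1}^N\frac{\partial}{\partial b_i},\qquad X_0=\sum_{i=1}^{N-1}a_i\frac{\partial}{\partial a_i}+\sum_{i=1}^N b_i\frac{\partial}{\partial b_i},$$ $$X_1=\sum_{n=1}^{N-1}\bigl(-n\,a_nb_n+(n+2)\,a_nb_{n+1}\bigr)\frac{\partial}{\partial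 a_n}+\sum_{n=1}^{N}\bigl((2n+3)a_n^2+(1-2n)a_{n-1}^2+b_n^2\bigr)\frac{\partial}{\partial b_n},$$ $X_2$ is the vector field given by the equation $\dot L=[B,L]+L^3$, where $B$ is the pentadiagonal skew-symmetric matrix with $$B_{n,n+1}=a_n\Bigl((n+c)(b_n+b_{n+1})+\sum_{k=1}^{n-1}b_k+\kappa\operatorname{tr}L\Bigr),\qquad B_{n,n+2}=(n+c)\,a_na_{n+1},$$ for arbitrary fixed real constants $c,\kappa$ (for this $B$ the right-hand side is symmetric and tridiagonal; the simplest choice is $c=\kappa=0$), and $X_n=\frac1{n-2}[X_1,X_{n-1}]$ for $n\ge3$. Then for every $n\ge-1$ the smooth time-dependent vector field $Y_n=X_n+t\,\chi_{n+2}$ is a symmetry of the Toda equations, that is, $$\frac{\partial Y_n}{\partial t}+[\chi_2,Y_n]=0,$$ where $[V,W]=DW\cdot V-DV\cdot W$ is the Lie bracket of vector fields. -/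

import Mathlib

open scoped ContDiff

noncomputable section

namespace Toda

/-- The phase space `ℝ^(2N-1)` of the finite nonperiodic Toda lattice with `N` particles: a point
is a pair `(a, b)`, `a = (a_1, …, a_{N-1})`, `b = (b_1, …, b_N)`. -/
abbrev Phase (N : ℕ) : Type := (Fin (N - 1) → ℝ) × (Fin N → ℝ)

variable {N : ℕ}

/-- The coordinate `a_n`, `1 ≤ n ≤ N - 1` (numbered from `1`), with the convention `a_n = 0` for
all other `n`, in particular `a_0 = a_N = 0`. -/
def ca (x : Phase N) (n : ℕ) : ℝ :=
  if h : 1 ≤ n ∧ n ≤ N - 1 then x.1 ⟨n - 1, by omega⟩ else 0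

/-- The coordinate `b_n`, `1 ≤ n ≤ N` (numbered from `1`), and `0` for all other `n`. -/
def cb (x : Phase N) (n : ℕ) : ℝ :=
  if h : 1 ≤ n ∧ n ≤ N then x.2 ⟨n - 1, by omega⟩ else 0

/-- The vector field `∑ φ_n ∂/∂a_n + ∑ ψ_n ∂/∂b_n`, the coefficients being numbered from `1`. -/
def mkField (φ ψ : ℕ → Phase N → ℝ) : Phase N → Phase N :=
  fun x => (fun i => φ (i.val + 1) x, fun i => ψ (i.val + 1) x)

/-- The right-hand side of the Toda equations
`a_n' = a_n (b_{n+1} - b_n)`, `b_n' = 2 (a_n² - a_{n-1}²)`. -/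
def todaField (N : ℕ) : Phase N → Phase N :=
  mkField (fun n x => ca x n * (cb x (n + 1) - cb x n))
    (fun n x => 2 * (ca x n ^ 2 - ca x (n - 1) ^ 2))

/-- The symmetric tridiagonal (Jacobi) matrix `L` with diagonal `b_1, …, b_N` and off-diagonal
`a_1, …, a_{N-1}`. -/
def jacobi (x : Phase N) : Matrix (Fin N) (Fin N) ℝ :=
  Matrix.of fun i j =>
    if i.val = j.val then cb x (i.val + 1)
    else if i.val + 1 = j.val then ca x (i.val + 1)
    else if j.val + 1 = i.val then ca x (j.val + 1)
    else 0

/-- `H_l = (1 / l) tr (L ^ l)`, for `l ≥ 1`. -/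
def ham (N l : ℕ) (x : Phase N) : ℝ := (1 / (l : ℝ)) * (jacobi x ^ l).trace

/-- `∂f/∂a_n`, for `1 ≤ n ≤ N - 1` (numbered from `1`). -/
def da (f : Phase N → ℝ) (n : ℕ) (x : Phase N) : ℝ :=
  if h : 1 ≤ n ∧ n ≤ N - 1 then fderiv ℝ f x (Pi.single ⟨n - 1, by omega⟩ 1, 0) else 0

/-- `∂f/∂b_n`, for `1 ≤ n ≤ N` (numbered from `1`). -/
def db (f : Phase N → ℝ) (n : ℕ) (x : Phase N) : ℝ :=
  if h : 1 ≤ n ∧ n ≤ N then fderiv ℝ f x (0, Pi.single ⟨n - 1, by omega⟩ 1) else 0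

/-- The linear (Lie–Poisson) Toda bracket `π_1`, that is the bracket with
`{a_n, b_n} = -a_n`, `{a_n, b_{n+1}} = a_n`, all other brackets of coordinates being zero. -/
def bracket (f g : Phase N → ℝ) (x : Phase N) : ℝ :=
  ∑ n ∈ Finset.Icc 1 (N - 1),
    (-ca x n * (da f n x * db g n x - db f n x * da g n x) +
      ca x n * (da f n x * db g (n + 1) x - db f (n + 1) x * da g n x))

/-- The Hamiltonian vector field of `h` with respect to `π_1`:
`a_n' = {a_n, h}`, `b_n' = {b_n, h}`. -/
def hamField (h : Phase N → ℝ) : Phase N → Phase N :=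
  mkField (fun n => bracket (fun y => ca y n) h) (fun n => bracket (fun y => cb y n) h)

/-- `χ_l`, the Hamiltonian vector field of `H_l` with respect to `π_1`. -/
def chi (N l : ℕ) : Phase N → Phase N := hamField (ham N l)

/-- `X_{-1} = ∑ ∂/∂b_n`, the gradient of `H_1 = tr L`. -/
def masterNegOne (N : ℕ) : Phase N → Phase N := mkField (fun _ _ => 0) (fun _ _ => 1)

/-- The Euler vector field `X_0`. -/
def masterZero (N : ℕ) : Phase N → Phase N := mkField (fun n x => ca x n) (fun n x => cb x n)

/-- The vector field `X_1`. -/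
def masterOne (N : ℕ) : Phase N → Phase N :=
  mkField
    (fun n x => -(n : ℝ) * ca x n * cb x n + ((n : ℝ) + 2) * ca x n * cb x (n + 1))
    (fun n x => (2 * (n : ℝ) + 3) * ca x n ^ 2 + (1 - 2 * (n : ℝ)) * ca x (n - 1) ^ 2
      + cb x n ^ 2)

/-- The strictly upper triangular part of the pentadiagonal skew-symmetric matrix `B` in the
equation `L' = [B, L] + L ^ 3` that defines `X_2`:
`B_{n,n+1} = a_n ((n + c) (b_n + b_{n+1}) + ∑_{k<n} b_k + κ tr L)` and
`B_{n,n+2} = (n + c) a_n a_{n+1}`. -/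
def upperTwo (c κ : ℝ) (x : Phase N) : Matrix (Fin N) (Fin N) ℝ :=
  Matrix.of fun i j =>
    if i.val + 1 = j.val then
      ca x (i.val + 1) * (((i.val + 1 : ℕ) + c) * (cb x (i.val + 1) + cb x (i.val + 2))
        + ∑ k ∈ Finset.Ico 1 (i.val + 1), cb x k + κ * (jacobi x).trace)
    else if i.val + 2 = j.val then
      ((i.val + 1 : ℕ) + c) * ca x (i.val + 1) * ca x (i.val + 2)
    else 0

/-- The right-hand side `[B, L] + L ^ 3`, where `B` is skew-symmetric and pentadiagonal. -/
def rhsTwo (c κ : ℝ) (x : Phase N) : Matrix (Fin N) (Fin N) ℝ :=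
  (upperTwo c κ x - (upperTwo c κ x).transpose) * jacobi x
    - jacobi x * (upperTwo c κ x - (upperTwo c κ x).transpose) + jacobi x ^ 3

/-- The vector field `X_2`, read off from `L' = [B, L] + L ^ 3`: the coefficient of `∂/∂a_n` is the
entry `(n, n+1)` of the right-hand side, that of `∂/∂b_n` is the entry `(n, n)`. -/
def masterTwo (N : ℕ) (c κ : ℝ) : Phase N → Phase N :=
  fun x => (fun i => rhsTwo c κ x ⟨i.val, by omega⟩ ⟨i.val + 1, by omega⟩,
    fun i => rhsTwo c κ x i i)

theorem sum_jacobi_mul (x : Phase N) (i : Fin N) (v : ℕ → ℝ) :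
    ∑ k : Fin N, jacobi x i k * v k.val =
      ca x i.val * v (i.val - 1) + cb x (i.val + 1) * v i.val
        + ca x (i.val + 1) * v (i.val + 1) := by
  have key : ∀ k : Fin N, jacobi x i k * v k.val =
      (if k.val = i.val - 1 then ca x i.val * v k.val else 0)
      + (if k.val = i.val then cb x (i.val + 1) * v k.val else 0)
      + (if k.val = i.val + 1 then ca x (i.val + 1) * v k.val else 0) := by
    intro k
    have h0 : ca x 0 = 0 := by simp [ca]
    simp only [jacobi, Matrix.of_apply]
    rcases Nat.eq_zero_or_pos i.val with hi | hi
    · rw [hi, h0]; simp; grind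
    · grind
  have pick : ∀ (m : ℕ) (w : ℕ → ℝ),
      ∑ k : Fin N, (if k.val = m then w k.val else 0) = if m < N then w m else 0 := by
    intro m w
    rw [Fin.sum_univ_eq_sum_range (fun k => if k = m then w k else 0)]
    simp
  rw [Finset.sum_congr rfl (fun k _ => key k), Finset.sum_add_distrib, Finset.sum_add_distrib,
    pick _ (fun k => ca x i.val * v k), pick _ (fun k => cb x (i.val + 1) * v k),
    pick _ (fun k => ca x (i.val + 1) * v k), if_pos (by omega), if_pos i.isLt]
  split_ifs with h
  · rfl
  · have : ca x (i.val + 1) = 0 := by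
      simp only [ca]; rw [dif_neg (by omega)]
    simp [this]

theorem jacobi_transpose (x : Phase N) : (jacobi x).transpose = jacobi x := by
  ext i j
  simp only [jacobi, Matrix.transpose_apply, Matrix.of_apply]
  grind

theorem rhsTwo_transpose (c κ : ℝ) (x : Phase N) :
    (rhsTwo c κ x).transpose = rhsTwo c κ x := by
  simp only [rhsTwo, Matrix.transpose_add, Matrix.transpose_sub, Matrix.transpose_mul,
    Matrix.transpose_pow, jacobi_transpose, Matrix.transpose_transpose]
  noncomm_ring

theorem rhsTwo_eq_zero (c κ : ℝ) (x : Phase N) (i j : Fin N) (hij : i.val + 2 ≤ j.val) :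
    rhsTwo c κ x i j = 0 := by
  set U : ℕ → ℕ → ℝ := fun i j =>
    if i + 1 = j then
      ca x (i + 1) * (((i + 1 : ℕ) + c) * (cb x (i + 1) + cb x (i + 2))
        + ∑ k ∈ Finset.Ico 1 (i + 1), cb x k + κ * (jacobi x).trace)
    else if i + 2 = j then ((i + 1 : ℕ) + c) * ca x (i + 1) * ca x (i + 2)
    else 0 with hU
  set J : ℕ → ℕ → ℝ := fun i j =>
    if i = j then cb x (i + 1)
    else if i + 1 = j then ca x (i + 1)
    else if j + 1 = i then ca x (j + 1)
    else 0 with hJ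
  have hJe : ∀ i j : Fin N, jacobi x i j = J i.val j.val := fun i j => rfl
  have hsym : ∀ i j : Fin N, jacobi x i j = jacobi x j i := fun i j =>
    congrFun (congrFun (jacobi_transpose x) j) i
  have hBe : ∀ i j : Fin N, (upperTwo c κ x - (upperTwo c κ x).transpose) i j =
      U i.val j.val - U j.val i.val := fun i j => rfl
  have hBL : ((upperTwo c κ x - (upperTwo c κ x).transpose) * jacobi x) i j =
      ca x j.val * (U i.val (j.val - 1) - U (j.val - 1) i.val)
      + cb x (j.val + 1) * (U i.val j.val - U j.val i.val)
      + ca x (j.val + 1) * (U i.val (j.val + 1) - U (j.val + 1) i.val) := by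
    rw [Matrix.mul_apply, ← sum_jacobi_mul x j (fun k => U i.val k - U k i.val)]
    exact Finset.sum_congr rfl fun k _ => by rw [hBe, hsym k j, mul_comm]
  have hLB : (jacobi x * (upperTwo c κ x - (upperTwo c κ x).transpose)) i j =
      ca x i.val * (U (i.val - 1) j.val - U j.val (i.val - 1))
      + cb x (i.val + 1) * (U i.val j.val - U j.val i.val)
      + ca x (i.val + 1) * (U (i.val + 1) j.val - U j.val (i.val + 1)) := by
    rw [Matrix.mul_apply, ← sum_jacobi_mul x i (fun k => U k j.val - U j.val k)]
    exact Finset.sum_congr rfl fun k _ => by rw [hBe]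
  have hL2 : ∀ i : Fin N, (jacobi x * jacobi x) i j =
      ca x i.val * J (i.val - 1) j.val + cb x (i.val + 1) * J i.val j.val
      + ca x (i.val + 1) * J (i.val + 1) j.val := by
    intro i
    rw [Matrix.mul_apply, ← sum_jacobi_mul x i (fun k => J k j.val)]
    exact Finset.sum_congr rfl fun k _ => by rw [hJe k j]
  have hL3 := sum_jacobi_mul x i (fun m => ca x m * J (m - 1) j.val + cb x (m + 1) * J m j.val
      + ca x (m + 1) * J (m + 1) j.val)
  have h3 : (jacobi x ^ 3) i j = ∑ k : Fin N, jacobi x i k * (ca x k.val * J (k.val - 1) j.val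
      + cb x (k.val + 1) * J k.val j.val + ca x (k.val + 1) * J (k.val + 1) j.val) := by
    rw [pow_succ', pow_two, Matrix.mul_apply]
    exact Finset.sum_congr rfl fun k _ => by rw [hL2 k]
  rw [rhsTwo, Matrix.add_apply, Matrix.sub_apply, hBL, hLB, h3, hL3]
  have h0 : ca x 0 = 0 := by simp [ca]
  generalize i.val = p at *
  generalize j.val = q at *
  clear hL3 h3 hL2 hLB hBL hBe hJe hsym
  obtain ⟨d, rfl⟩ := Nat.exists_eq_add_of_le hij
  have hs : ∀ m, ∑ k ∈ Finset.Ico 1 (m + 1 + 1), cb x k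
      = ∑ k ∈ Finset.Ico 1 (m + 1), cb x k + cb x (m + 1) := fun m =>
    Finset.sum_Ico_succ_top (by omega) _
  rcases d with _ | _ | d <;> rcases p with _ | p
  · simp [hU, hJ, h0]
    ring
  · simp [hU, hJ, hs, add_assoc]
    ring_nf
    rw [if_neg (by omega)]
  · simp [hU, hJ, h0]
    ring
  · simp [hU, hJ, add_assoc]
    ring_nf
    rw [if_neg (by omega)]
  · simp [hU, hJ, h0]
    grind
  · simp [hU, hJ, add_assoc]
    grind

/-- `X_2` really is given by `L' = [B, L] + L ^ 3` (`L` is linear in the coordinates): the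
right-hand side of this equation is a symmetric tridiagonal matrix. -/
theorem jacobi_masterTwo (c κ : ℝ) (x : Phase N) :
    jacobi (masterTwo N c κ x) = rhsTwo c κ x := by
  have hT : ∀ i j, rhsTwo c κ x i j = rhsTwo c κ x j i := fun i j =>
    congrFun (congrFun (rhsTwo_transpose c κ x) j) i
  ext i j
  have hi := i.isLt
  have hj := j.isLt
  simp only [jacobi, Matrix.of_apply]
  split_ifs with h1 h2 h3
  · obtain rfl := Fin.ext h1
    simp only [cb]
    rw [dif_pos (by omega)]
    rfl
  · simp only [ca]
    rw [dif_pos (by omega)]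
    have : j = ⟨i.val + 1, by omega⟩ := Fin.ext h2.symm
    exact (congrArg (rhsTwo c κ x i) this).symm
  · simp only [ca]
    rw [dif_pos (by omega), hT]
    have : i = ⟨j.val + 1, by omega⟩ := Fin.ext h3.symm
    exact (congrArg (rhsTwo c κ x j) this).symm
  · rcases lt_or_ge i.val j.val with h | h
    · exact (rhsTwo_eq_zero c κ x i j (by omega)).symm
    · rw [hT]
      exact (rhsTwo_eq_zero c κ x j i (by omega)).symm

/-- The vector fields `X_n`, `n ≥ 0`: after `X_0`, `X_1`, `X_2` the sequence is continued by
`[X_1, X_{n-1}] = (n - 2) X_n`, `n ≥ 3`. -/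
def masterNat (N : ℕ) (c κ : ℝ) : ℕ → Phase N → Phase N
  | 0 => masterZero N
  | 1 => masterOne N
  | 2 => masterTwo N c κ
  | n + 3 => fun x => (1 / ((n : ℝ) + 1)) •
      VectorField.lieBracket ℝ (masterOne N) (masterNat N c κ (n + 2)) x

/-- The vector fields `X_n`, `n ≥ -1` (the value for `n < -1` is irrelevant). -/
def master (N : ℕ) (c κ : ℝ) (n : ℤ) : Phase N → Phase N :=
  if n < 0 then masterNegOne N else masterNat N c κ n.toNat

/-- The time-dependent vector field `Y_n = X_n + t χ_{n+2}`, `n ≥ -1`. -/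
def timeField (N : ℕ) (c κ : ℝ) (n : ℤ) (t : ℝ) : Phase N → Phase N :=
  fun x => master N c κ n x + t • chi N (n + 2).toNat x

/-- The smooth time-dependent vector field `Z` is a symmetry of the equation `x' = χ(x)`:
`∂Z/∂t + [χ, Z] = 0`, where `[V, W] = DW(V) - DV(W)` is the usual Lie bracket. -/
def IsSymmetry (χ : Phase N → Phase N) (Z : ℝ → Phase N → Phase N) : Prop :=
  ContDiff ℝ ∞ (fun p : ℝ × Phase N => Z p.1 p.2) ∧
    ∀ (t : ℝ) (x : Phase N),
      deriv (fun s => Z s x) t + VectorField.lieBracket ℝ χ (Z t) x = 0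

end Toda

end

open scoped ContDiff

noncomputable section

namespace Toda

variable {N : ℕ}

/-! The core is the relation `[X_n, χ_{k+1}] = k χ_{k+1+n}` for `n ≥ 0` and all `k ≥ 0`
(`lieBracket_masterNat_chi`). For `k = 1` it gives `[χ_2, X_n] = -χ_{n+2}`; together with `[χ_2,
χ_l] = 0` the bracket of `χ_2` with `X_n + t χ_{n+2}` is `-χ_{n+2}`, which cancels the
`t`-derivative.

For `n = 0, 1, 2` the field `X_n` has a Lax form `L' = [B, L] + L^{n+1}` with `B` skew-symmetric and
banded. The commutator with `B` is a derivation, so `(L^k)' = [B, L^k] + k L^{k+n}` along `X_n`. In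
coordinates `χ_{k+1}` is linear in the entries of `L^k`, with coefficients taken from `a` (`za_chi`,
`zb_chi`). The term `k L^{k+n}` therefore contributes exactly `k χ_{k+1+n}`, and it remains to match
the derivative of `X_n` along `χ_{k+1}` with the terms in `[B, L^k]` and in the `a`-components of
`X_n` (`lieBracket_chi_of_lax`). This is an identity linear in the entries of `M = L^k`; it uses
only that `M` is symmetric and commutes with `L`. The same lemma without the power term, applied to
`χ_2` itself, gives the commutation of the Toda flows.

For `n ≥ 3` the relation follows from the recursion by the Jacobi identity. For `n = -1`, the Toda
field is invariant under a common shift of all `b_i`, and `χ_1 = 0`. -/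

/-! ### Coordinates and matrix entries indexed by all integers, extended by zero. -/

/-- The coordinate `a_n` for an integer `n`, zero outside `1 ≤ n ≤ N - 1`. -/
def za (x : Phase N) (n : ℤ) : ℝ := ca x n.toNat

/-- The coordinate `b_n` for an integer `n`, zero outside `1 ≤ n ≤ N`. -/
def zb (x : Phase N) (n : ℤ) : ℝ := cb x n.toNat

theorem za_eq_zero (x : Phase N) {n : ℤ} (h : n < 1 ∨ (N : ℤ) ≤ n) : za x n = 0 := by
  simp only [za, ca]
  rw [dif_neg (by omega)]

theorem zb_eq_zero (x : Phase N) {n : ℤ} (h : n < 1 ∨ (N : ℤ) < n) : zb x n = 0 := by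
  simp only [zb, cb]
  rw [dif_neg (by omega)]

theorem za_natCast (x : Phase N) (n : ℕ) : za x n = ca x n := by simp [za]

theorem zb_natCast (x : Phase N) (n : ℕ) : zb x n = cb x n := by simp [zb]

theorem phase_ext {x y : Phase N} (ha : ∀ n : ℤ, 1 ≤ n → n < N → za x n = za y n)
    (hb : ∀ n : ℤ, 1 ≤ n → n ≤ N → zb x n = zb y n) : x = y := by
  refine Prod.ext (funext fun i => ?_) (funext fun i => ?_)
  · have h := ha (i.val + 1 : ℕ) (by omega) (by omega)
    rw [za_natCast, za_natCast] at h
    simpa [ca, show i.val + 1 ≤ N - 1 by omega] using h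
  · have h := hb (i.val + 1 : ℕ) (by omega) (by omega)
    rw [zb_natCast, zb_natCast] at h
    simpa [cb, show i.val + 1 ≤ N by omega] using h

/-- The entry `(i, j)` of a matrix, numbered from `1`, and zero outside the matrix. -/
def ent (M : Matrix (Fin N) (Fin N) ℝ) (i j : ℤ) : ℝ :=
  if h : (1 ≤ i ∧ i ≤ N) ∧ 1 ≤ j ∧ j ≤ N then
    M ⟨(i - 1).toNat, by omega⟩ ⟨(j - 1).toNat, by omega⟩ else 0

theorem ent_eq_zero (M : Matrix (Fin N) (Fin N) ℝ) {i j : ℤ}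
    (h : ¬((1 ≤ i ∧ i ≤ N) ∧ 1 ≤ j ∧ j ≤ N)) : ent M i j = 0 := dif_neg h

theorem ent_apply (M : Matrix (Fin N) (Fin N) ℝ) (i j : Fin N) :
    ent M (i.val + 1) (j.val + 1) = M i j := by
  unfold ent
  rw [dif_pos (by omega)]
  congr <;> simp

theorem ent_ext {M M' : Matrix (Fin N) (Fin N) ℝ} (h : ∀ i j, ent M i j = ent M' i j) :
    M = M' := by
  ext i j
  simpa [ent_apply] using h (i.val + 1) (j.val + 1)

theorem ent_add (M M' : Matrix (Fin N) (Fin N) ℝ) (i j : ℤ) :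
    ent (M + M') i j = ent M i j + ent M' i j := by
  unfold ent; split_ifs <;> simp

theorem ent_smul (r : ℝ) (M : Matrix (Fin N) (Fin N) ℝ) (i j : ℤ) :
    ent (r • M) i j = r * ent M i j := by
  unfold ent; split_ifs <;> simp

theorem ent_zero (i j : ℤ) : ent (0 : Matrix (Fin N) (Fin N) ℝ) i j = 0 := by
  unfold ent; split_ifs <;> simp

theorem ent_transpose (M : Matrix (Fin N) (Fin N) ℝ) (i j : ℤ) :
    ent M.transpose i j = ent M j i := by
  unfold ent; split_ifs <;> first | rfl | omega

theorem ent_mul (A M : Matrix (Fin N) (Fin N) ℝ) (i j : ℤ) :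
    ent (A * M) i j = ∑ k ∈ Finset.Icc (1 : ℤ) N, ent A i k * ent M k j := by
  by_cases h : (1 ≤ i ∧ i ≤ N) ∧ 1 ≤ j ∧ j ≤ N
  · obtain ⟨i, rfl⟩ : ∃ i' : Fin N, i = i'.val + 1 := ⟨⟨(i - 1).toNat, by omega⟩, by simp; omega⟩
    obtain ⟨j, rfl⟩ : ∃ j' : Fin N, j = j'.val + 1 := ⟨⟨(j - 1).toNat, by omega⟩, by simp; omega⟩
    rw [ent_apply, Matrix.mul_apply]
    refine Finset.sum_bij (fun k _ => (k.val : ℤ) + 1) ?_ ?_ ?_ ?_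
    · intro k _; simp
    · intro k _ l _ h; exact Fin.ext (by simpa using h)
    · intro k hk
      rw [Finset.mem_Icc] at hk
      exact ⟨⟨(k - 1).toNat, by omega⟩, Finset.mem_univ _, by simp; omega⟩
    · intro k _
      rw [ent_apply, ent_apply]
  · rw [ent_eq_zero _ h]
    refine (Finset.sum_eq_zero fun k _ => ?_).symm
    by_cases hi : 1 ≤ i ∧ i ≤ N
    · rw [ent_eq_zero M (by tauto), mul_zero]
    · rw [ent_eq_zero A (by tauto), zero_mul]

/-- The five neighbours of `i` may leave the range `1, …, N`, where `ent M` is zero, and the other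
indices of the range are killed by the band condition. Hence both sums agree with the sum over the
union, and no boundary cases arise later. -/
theorem ent_mul_of_band {A : Matrix (Fin N) (Fin N) ℝ}
    (hA : ∀ i j, i + 2 < j ∨ j + 2 < i → ent A i j = 0)
    (M : Matrix (Fin N) (Fin N) ℝ) (i j : ℤ) :
    ent (A * M) i j = ent A i (i - 2) * ent M (i - 2) j + ent A i (i - 1) * ent M (i - 1) j
      + ent A i i * ent M i j + ent A i (i + 1) * ent M (i + 1) j
      + ent A i (i + 2) * ent M (i + 2) j := by
  have h1 : ∑ k ∈ Finset.Icc (1 : ℤ) N, ent A i k * ent M k j =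
      ∑ k ∈ Finset.Icc (1 : ℤ) N ∪ Finset.Icc (i - 2) (i + 2), ent A i k * ent M k j := by
    refine Finset.sum_subset Finset.subset_union_left fun k _ hk => ?_
    rw [Finset.mem_Icc] at hk
    rw [ent_eq_zero M (by tauto), mul_zero]
  have h2 : ∑ k ∈ Finset.Icc (i - 2) (i + 2), ent A i k * ent M k j =
      ∑ k ∈ Finset.Icc (1 : ℤ) N ∪ Finset.Icc (i - 2) (i + 2), ent A i k * ent M k j := by
    refine Finset.sum_subset Finset.subset_union_right fun k _ hk => ?_
    rw [Finset.mem_Icc] at hk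
    rw [hA i k (by omega), zero_mul]
  have h3 : Finset.Icc (i - 2) (i + 2) = {i - 2, i - 1, i, i + 1, i + 2} := by
    ext k; simp only [Finset.mem_Icc, Finset.mem_insert, Finset.mem_singleton]; omega
  rw [ent_mul, h1, ← h2, h3]
  repeat rw [Finset.sum_insert (by simp <;> omega)]
  rw [Finset.sum_singleton]
  ring

theorem ent_jacobi (x : Phase N) (i j : ℤ) :
    ent (jacobi x) i j = if i = j then zb x i else if i + 1 = j then za x i
      else if j + 1 = i then za x j else 0 := by
  by_cases h : (1 ≤ i ∧ i ≤ N) ∧ 1 ≤ j ∧ j ≤ N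
  · obtain ⟨i, rfl⟩ : ∃ i' : Fin N, i = i'.val + 1 := ⟨⟨(i - 1).toNat, by omega⟩, by simp; omega⟩
    obtain ⟨j, rfl⟩ : ∃ j' : Fin N, j = j'.val + 1 := ⟨⟨(j - 1).toNat, by omega⟩, by simp; omega⟩
    rw [ent_apply]
    simp only [jacobi, Matrix.of_apply]
    have hz : ∀ k : ℕ, ((k : ℤ) + 1).toNat = k + 1 := fun k => by omega
    simp only [za, zb, hz]
    grind
  · rw [ent_eq_zero _ h]
    split_ifs with h1 h2 h3
    · rw [zb_eq_zero]; omega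
    · rw [za_eq_zero]; omega
    · rw [za_eq_zero]; omega
    · rfl

theorem ent_jacobi_mul (x : Phase N) (M : Matrix (Fin N) (Fin N) ℝ) (i j : ℤ) :
    ent (jacobi x * M) i j = za x (i - 1) * ent M (i - 1) j + zb x i * ent M i j
      + za x i * ent M (i + 1) j := by
  rw [ent_mul_of_band]
  · simp only [ent_jacobi]
    have h1 : i ≠ i - 2 := by omega
    have h2 : i + 1 ≠ i - 2 := by omega
    have h3 : i - 2 + 1 ≠ i := by omega
    have h4 : i ≠ i - 1 := by omega
    have h5 : i + 1 ≠ i - 1 := by omega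
    have h6 : i + 2 + 1 ≠ i := by omega
    simp [h1, h2, h3, h4, h5, h6]
  · intro i j h
    rw [ent_jacobi, if_neg (by omega), if_neg (by omega), if_neg (by omega)]

theorem ent_mul_jacobi (x : Phase N) (M : Matrix (Fin N) (Fin N) ℝ) (i j : ℤ) :
    ent (M * jacobi x) i j = za x (j - 1) * ent M i (j - 1) + zb x j * ent M i j
      + za x j * ent M i (j + 1) := by
  rw [← ent_transpose, Matrix.transpose_mul, jacobi_transpose, ent_jacobi_mul]
  simp only [ent_transpose]

/-- The commutator of a banded skew-symmetric matrix with a symmetric matrix. -/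
theorem ent_commutator {B : Matrix (Fin N) (Fin N) ℝ}
    (hB : ∀ i j, i + 2 < j ∨ j + 2 < i → ent B i j = 0) (hB' : B.transpose = -B)
    {M : Matrix (Fin N) (Fin N) ℝ} (hM : M.transpose = M) (i j : ℤ) :
    ent (B * M - M * B) i j =
      ent B i (i + 1) * ent M (i + 1) j + ent B i (i + 2) * ent M (i + 2) j
      - ent B (i - 1) i * ent M (i - 1) j - ent B (i - 2) i * ent M (i - 2) j
      + ent B j (j + 1) * ent M i (j + 1) + ent B j (j + 2) * ent M i (j + 2)
      - ent B (j - 1) j * ent M i (j - 1) - ent B (j - 2) j * ent M i (j - 2) := by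
  have hs : ∀ i j, ent B i j = -ent B j i := fun i j => by
    rw [← ent_transpose B j i, hB']
    have := ent_smul (-1) B j i
    rw [neg_one_smul] at this
    rw [this, neg_one_mul]
  have hm : ∀ i j, ent M i j = ent M j i := fun i j => by rw [← ent_transpose, hM]
  have h0 : ∀ i, ent B i i = 0 := fun i => by linarith [hs i i]
  -- The commutator is `BM + (BM)ᵀ`, so one banded product determines it.
  have hT : M * B = -(B * M).transpose := by
    rw [Matrix.transpose_mul, hB', hM]; simp
  rw [hT, sub_neg_eq_add, ent_add, ent_transpose, ent_mul_of_band hB, ent_mul_of_band hB]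
  rw [hs i (i - 2), hs i (i - 1), hs j (j - 2), hs j (j - 1), h0, h0, hm i (j - 2), hm i (j - 1),
    hm i j, hm i (j + 1), hm i (j + 2)]
  ring

/-! ### Smoothness and directional derivatives of the coordinates. -/

theorem ca_add_smul (x v : Phase N) (s : ℝ) (n : ℕ) :
    ca (x + s • v) n = ca x n + s * ca v n := by
  unfold ca; split_ifs <;> simp

theorem cb_add_smul (x v : Phase N) (s : ℝ) (n : ℕ) :
    cb (x + s • v) n = cb x n + s * cb v n := by
  unfold cb; split_ifs <;> simp

theorem contDiff_ca (n : ℕ) : ContDiff ℝ ∞ fun x : Phase N => ca x n := by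
  unfold ca; split_ifs <;> fun_prop

theorem contDiff_cb (n : ℕ) : ContDiff ℝ ∞ fun x : Phase N => cb x n := by
  unfold cb; split_ifs <;> fun_prop

theorem hasLineDerivAt_ca (x v : Phase N) (n : ℕ) :
    HasLineDerivAt ℝ (fun y => ca y n) (ca v n) x v := by
  unfold HasLineDerivAt
  simp only [ca_add_smul]
  simpa using ((hasDerivAt_id (0 : ℝ)).mul_const (ca v n)).const_add (ca x n)

theorem hasLineDerivAt_cb (x v : Phase N) (n : ℕ) :
    HasLineDerivAt ℝ (fun y => cb y n) (cb v n) x v := by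
  unfold HasLineDerivAt
  simp only [cb_add_smul]
  simpa using ((hasDerivAt_id (0 : ℝ)).mul_const (cb v n)).const_add (cb x n)

theorem hasLineDerivAt_za (x v : Phase N) (n : ℤ) :
    HasLineDerivAt ℝ (fun y => za y n) (za v n) x v := hasLineDerivAt_ca x v _

theorem hasLineDerivAt_zb (x v : Phase N) (n : ℤ) :
    HasLineDerivAt ℝ (fun y => zb y n) (zb v n) x v := hasLineDerivAt_cb x v _

section LineDeriv

variable {E : Type*} [NormedAddCommGroup E] [NormedSpace ℝ E] {f g : E → ℝ} {f' g' : ℝ} {x v : E}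

theorem _root_.HasLineDerivAt.mul_real (hf : HasLineDerivAt ℝ f f' x v)
    (hg : HasLineDerivAt ℝ g g' x v) :
    HasLineDerivAt ℝ (fun y => f y * g y) (f' * g x + f x * g') x v := by
  have h := HasDerivAt.fun_mul hf hg
  simp only [zero_smul, add_zero] at h
  exact h

theorem _root_.HasLineDerivAt.add_real (hf : HasLineDerivAt ℝ f f' x v)
    (hg : HasLineDerivAt ℝ g g' x v) :
    HasLineDerivAt ℝ (fun y => f y + g y) (f' + g') x v := HasDerivAt.fun_add hf hg

theorem _root_.HasLineDerivAt.sub_real (hf : HasLineDerivAt ℝ f f' x v)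
    (hg : HasLineDerivAt ℝ g g' x v) :
    HasLineDerivAt ℝ (fun y => f y - g y) (f' - g') x v := HasDerivAt.fun_sub hf hg

theorem _root_.HasLineDerivAt.sum_real {ι : Type*} {s : Finset ι} {f : ι → E → ℝ} {f' : ι → ℝ}
    (hf : ∀ i ∈ s, HasLineDerivAt ℝ (f i) (f' i) x v) :
    HasLineDerivAt ℝ (fun y => ∑ i ∈ s, f i y) (∑ i ∈ s, f' i) x v := HasDerivAt.fun_sum hf

theorem _root_.HasLineDerivAt.const_mul_real (r : ℝ) (hf : HasLineDerivAt ℝ f f' x v) :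
    HasLineDerivAt ℝ (fun y => r * f y) (r * f') x v := HasDerivAt.const_mul r hf

theorem _root_.HasLineDerivAt.fderiv_real (hf : HasLineDerivAt ℝ f f' x v)
    (h : DifferentiableAt ℝ f x) : fderiv ℝ f x v = f' := by
  rw [← h.lineDeriv_eq_fderiv, hf.lineDeriv]

theorem hasLineDerivAt_const (r : ℝ) (x v : E) : HasLineDerivAt ℝ (fun _ => r) 0 x v :=
  hasDerivAt_const _ _

end LineDeriv

/-! ### Derivatives of the powers of `L` and of the Hamiltonians. -/

theorem contDiff_jacobi_pow (k : ℕ) (i j : Fin N) :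
    ContDiff ℝ ∞ fun x : Phase N => (jacobi x ^ k) i j := by
  have hL : ∀ i j : Fin N, ContDiff ℝ ∞ fun x : Phase N => jacobi x i j := by
    intro i j
    simp only [jacobi, Matrix.of_apply]
    split_ifs
    exacts [contDiff_cb _, contDiff_ca _, contDiff_ca _, contDiff_const]
  induction k generalizing i j with
  | zero => simpa using contDiff_const
  | succ k ih =>
    simp only [pow_succ, Matrix.mul_apply]
    exact ContDiff.sum fun l _ => (ih i l).mul (hL l j)

theorem contDiff_ent_jacobi_pow (k : ℕ) (i j : ℤ) :
    ContDiff ℝ ∞ fun x : Phase N => ent (jacobi x ^ k) i j := by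
  unfold ent
  split_ifs
  · exact contDiff_jacobi_pow k _ _
  · exact contDiff_const

/-- The derivative of `L ^ k` at `x` in the direction `v`. -/
def powDeriv (x v : Phase N) : ℕ → Matrix (Fin N) (Fin N) ℝ
  | 0 => 0
  | k + 1 => powDeriv x v k * jacobi x + jacobi x ^ k * jacobi v

theorem hasLineDerivAt_jacobi (x v : Phase N) (i j : Fin N) :
    HasLineDerivAt ℝ (fun y => jacobi y i j) (jacobi v i j) x v := by
  simp only [jacobi, Matrix.of_apply]
  split_ifs
  exacts [hasLineDerivAt_cb _ _ _, hasLineDerivAt_ca _ _ _, hasLineDerivAt_ca _ _ _,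
    hasLineDerivAt_const _ _ _]

theorem hasLineDerivAt_jacobi_pow (x v : Phase N) (k : ℕ) (i j : Fin N) :
    HasLineDerivAt ℝ (fun y => (jacobi y ^ k) i j) (powDeriv x v k i j) x v := by
  induction k generalizing i j with
  | zero => simpa [powDeriv] using hasLineDerivAt_const _ x v
  | succ k ih =>
    simp only [pow_succ, Matrix.mul_apply, powDeriv, Matrix.add_apply, ← Finset.sum_add_distrib]
    exact HasLineDerivAt.sum_real fun l _ => (ih i l).mul_real (hasLineDerivAt_jacobi x v l j)

theorem hasLineDerivAt_ent_jacobi_pow (x v : Phase N) (k : ℕ) (i j : ℤ) :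
    HasLineDerivAt ℝ (fun y => ent (jacobi y ^ k) i j) (ent (powDeriv x v k) i j) x v := by
  unfold ent
  split_ifs
  · exact hasLineDerivAt_jacobi_pow x v k _ _
  · exact hasLineDerivAt_const _ _ _

/-- Cyclicity of the trace makes every term of the Leibniz sum equal. The spare factor `L ^ m`
absorbs the powers that accumulate in the induction; where the exponent is truncated, the factor `k
= 0` makes it harmless. -/
theorem trace_powDeriv_mul (x v : Phase N) (k m : ℕ) :
    (powDeriv x v k * jacobi x ^ m).trace
      = k * (jacobi x ^ (k + m - 1) * jacobi v).trace := by
  induction k generalizing m with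
  | zero => simp [powDeriv]
  | succ k ih =>
    have h1 : powDeriv x v (k + 1) * jacobi x ^ m
        = powDeriv x v k * jacobi x ^ (m + 1) + jacobi x ^ k * (jacobi v * jacobi x ^ m) := by
      simp only [powDeriv, add_mul, mul_assoc, pow_succ']
    have h2 : (jacobi x ^ k * (jacobi v * jacobi x ^ m)).trace
        = (jacobi x ^ (m + k) * jacobi v).trace := by
      rw [← Matrix.mul_assoc, Matrix.trace_mul_comm, ← Matrix.mul_assoc, ← pow_add]
    rw [h1, Matrix.trace_add, ih, h2, show k + (m + 1) - 1 = m + k by omega, show k + 1 + m - 1 = m + k by omega]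
    push_cast
    ring

theorem contDiff_ham (l : ℕ) : ContDiff ℝ ∞ (ham N l) := by
  unfold ham Matrix.trace
  simp only [Matrix.diag_apply]
  exact contDiff_const.mul (ContDiff.sum fun i _ => contDiff_jacobi_pow l i i)

theorem fderiv_ham (k : ℕ) (x v : Phase N) :
    fderiv ℝ (ham N (k + 1)) x v = (jacobi x ^ k * jacobi v).trace := by
  have h : HasLineDerivAt ℝ (ham N (k + 1))
      (1 / ((k + 1 : ℕ) : ℝ) * (powDeriv x v (k + 1)).trace) x v :=
    (HasLineDerivAt.sum_real fun i _ => hasLineDerivAt_jacobi_pow x v (k + 1) i i).const_mul_real _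
  rw [h.fderiv_real ((contDiff_ham _).differentiable (by simp) x)]
  have := trace_powDeriv_mul x v (k + 1) 0
  rw [pow_zero, mul_one] at this
  rw [this, show k + 1 + 0 - 1 = k by omega, ← mul_assoc, one_div, inv_mul_cancel₀, one_mul]
  positivity

theorem jacobi_pow_transpose (x : Phase N) (k : ℕ) :
    (jacobi x ^ k).transpose = jacobi x ^ k := by
  rw [Matrix.transpose_pow, jacobi_transpose]

theorem trace_eq_sum_ent (M : Matrix (Fin N) (Fin N) ℝ) :
    M.trace = ∑ k ∈ Finset.Icc (1 : ℤ) N, ent M k k := by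
  rw [Matrix.trace]
  refine Finset.sum_bij (fun k _ => (k.val : ℤ) + 1) ?_ ?_ ?_ ?_
  · intro k _; simp
  · intro k _ l _ h; exact Fin.ext (by simpa using h)
  · intro k hk
    rw [Finset.mem_Icc] at hk
    exact ⟨⟨(k - 1).toNat, by omega⟩, Finset.mem_univ _, by simp; omega⟩
  · intro k _
    rw [ent_apply, Matrix.diag_apply]

/-! ### The fields `χ_l` in coordinates. -/

theorem za_single_a (i : Fin (N - 1)) (n : ℤ) :
    za ((Pi.single i 1, 0) : Phase N) n = if n = i.val + 1 then 1 else 0 := by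
  simp only [za, ca, Pi.single_apply, Fin.ext_iff]
  grind

theorem zb_single_a (i : Fin (N - 1)) (n : ℤ) :
    zb ((Pi.single i 1, 0) : Phase N) n = 0 := by
  simp [zb, cb]

theorem za_single_b (i : Fin N) (n : ℤ) :
    za ((0, Pi.single i 1) : Phase N) n = 0 := by
  simp [za, ca]

theorem zb_single_b (i : Fin N) (n : ℤ) :
    zb ((0, Pi.single i 1) : Phase N) n = if n = i.val + 1 then 1 else 0 := by
  simp only [zb, cb, Pi.single_apply, Fin.ext_iff]
  grind

/-- The factor 2 appears because `a_n` occupies two symmetric entries of `L`. -/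
theorem da_ham (k n : ℕ) (hn : 1 ≤ n ∧ n ≤ N - 1) (x : Phase N) :
    da (ham N (k + 1)) n x = 2 * ent (jacobi x ^ k) n (n + 1) := by
  rw [da, dif_pos hn, fderiv_ham, trace_eq_sum_ent]
  have hs : ∀ i j, ent (jacobi x ^ k) i j = ent (jacobi x ^ k) j i := fun i j => by
    rw [← ent_transpose, jacobi_pow_transpose]
  have hc : ((n - 1 : ℕ) : ℤ) + 1 = n := by omega
  simp only [ent_mul_jacobi, za_single_a, zb_single_a, hc, zero_mul, add_zero, ite_mul, one_mul,
    Finset.sum_add_distrib, sub_eq_iff_eq_add, Finset.sum_ite_eq', Finset.mem_Icc]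
  rw [if_pos (by omega), if_pos (by omega), add_sub_cancel_right, hs]
  ring

theorem db_ham (k n : ℕ) (hn : 1 ≤ n ∧ n ≤ N) (x : Phase N) :
    db (ham N (k + 1)) n x = ent (jacobi x ^ k) n n := by
  rw [db, dif_pos hn, fderiv_ham, trace_eq_sum_ent]
  have hc : ((n - 1 : ℕ) : ℤ) + 1 = n := by omega
  simp only [ent_mul_jacobi, za_single_b, zb_single_b, hc, zero_mul, add_zero, zero_add, ite_mul,
    one_mul, Finset.sum_ite_eq', Finset.mem_Icc]
  rw [if_pos (by omega)]

theorem fderiv_ca (n : ℕ) (x v : Phase N) : fderiv ℝ (fun y => ca y n) x v = ca v n :=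
  (hasLineDerivAt_ca x v n).fderiv_real ((contDiff_ca n).differentiable (by simp) x)

theorem fderiv_cb (n : ℕ) (x v : Phase N) : fderiv ℝ (fun y => cb y n) x v = cb v n :=
  (hasLineDerivAt_cb x v n).fderiv_real ((contDiff_cb n).differentiable (by simp) x)

theorem db_ca (n m : ℕ) (x : Phase N) : db (fun y => ca y n) m x = 0 := by
  unfold db
  split_ifs
  · rw [fderiv_ca]; simp [ca]
  · rfl

theorem da_cb (n m : ℕ) (x : Phase N) : da (fun y => cb y n) m x = 0 := by
  unfold da
  split_ifs
  · rw [fderiv_cb]; simp [cb]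
  · rfl

theorem da_ca (n m : ℕ) (hn : 1 ≤ n ∧ n ≤ N - 1) (x : Phase N) :
    da (fun y => ca y n) m x = if m = n then 1 else 0 := by
  unfold da
  split_ifs with h1 h2 h2
  · rw [fderiv_ca, ← za_natCast, za_single_a, if_pos (by simp; omega)]
  · rw [fderiv_ca, ← za_natCast, za_single_a, if_neg (by simp; omega)]
  · omega
  · rfl

theorem db_cb (n m : ℕ) (hn : 1 ≤ n ∧ n ≤ N) (x : Phase N) :
    db (fun y => cb y n) m x = if m = n then 1 else 0 := by
  unfold db
  split_ifs with h1 h2 h2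
  · rw [fderiv_cb, ← zb_natCast, zb_single_b, if_pos (by simp; omega)]
  · rw [fderiv_cb, ← zb_natCast, zb_single_b, if_neg (by simp; omega)]
  · omega
  · rfl

/-- This and `zb_chi` are the only facts about the Poisson bracket used afterwards: they turn
`χ_{k+1}` into an expression linear in `L ^ k`. Both hold for every integer index, since the
relevant `a`'s vanish outside the lattice. -/
theorem za_chi (k : ℕ) (x : Phase N) (n : ℤ) :
    za (chi N (k + 1) x) n
      = za x n * (ent (jacobi x ^ k) (n + 1) (n + 1) - ent (jacobi x ^ k) n n) := by
  by_cases hn : 1 ≤ n ∧ n < N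
  · obtain ⟨n, rfl⟩ := Int.eq_ofNat_of_zero_le (by omega : 0 ≤ n)
    rw [za_natCast, ca, dif_pos (by omega)]
    simp only [chi, hamField, mkField]
    rw [Nat.sub_add_cancel (by omega)]
    simp only [bracket, db_ca, da_ca n _ (by omega : 1 ≤ n ∧ n ≤ N - 1)]
    have e : ∀ m ∈ Finset.Icc 1 (N - 1), (-ca x m * ((if m = n then 1 else 0)
          * db (ham N (k + 1)) m x - 0 * da (ham N (k + 1)) m x)
        + ca x m * ((if m = n then 1 else 0) * db (ham N (k + 1)) (m + 1) x
          - 0 * da (ham N (k + 1)) m x)) = if m = n then ca x n * (db (ham N (k + 1)) (n + 1) x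
            - db (ham N (k + 1)) n x) else 0 := by
      intro m _
      split_ifs with h
      · subst h; ring
      · ring
    rw [Finset.sum_congr rfl e, Finset.sum_ite_eq', if_pos (by simp; omega),
      db_ham k n (by omega), db_ham k (n + 1) (by omega), za_natCast]
    push_cast
    rfl
  · rw [za_eq_zero _ (by omega), za_eq_zero _ (by omega), zero_mul]

theorem zb_chi (k : ℕ) (x : Phase N) (n : ℤ) :
    zb (chi N (k + 1) x) n
      = 2 * (za x n * ent (jacobi x ^ k) n (n + 1)
        - za x (n - 1) * ent (jacobi x ^ k) (n - 1) n) := by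
  by_cases hn : 1 ≤ n ∧ n ≤ N
  · obtain ⟨n, rfl⟩ : ∃ m : ℕ, n = (m + 1 : ℕ) := ⟨(n - 1).toNat, by omega⟩
    rw [zb_natCast, cb, dif_pos (by omega)]
    simp only [chi, hamField, mkField, Nat.add_sub_cancel]
    simp only [bracket, da_cb, db_cb (n + 1) _ (by omega : 1 ≤ n + 1 ∧ n + 1 ≤ N)]
    have e : ∀ m ∈ Finset.Icc 1 (N - 1), (-ca x m * (0 * db (ham N (k + 1)) m x
          - (if m = n + 1 then 1 else 0) * da (ham N (k + 1)) m x)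
        + ca x m * (0 * db (ham N (k + 1)) (m + 1) x
          - (if m + 1 = n + 1 then 1 else 0) * da (ham N (k + 1)) m x))
        = (if m = n + 1 then 2 * (za x (n + 1 : ℕ) * ent (jacobi x ^ k) (n + 1 : ℕ) (n + 1 + 1))
            else 0) - (if m = n then 2 * (za x n * ent (jacobi x ^ k) n (n + 1)) else 0) := by
      intro m hm
      rw [da_ham k m (by simpa using hm), ← za_natCast]
      by_cases h1 : m = n + 1
      · subst h1; simp; ring
      · by_cases h2 : m = n
        · subst h2; simp; ring
        · simp [h1, h2]
    rw [Finset.sum_congr rfl e, Finset.sum_sub_distrib, Finset.sum_ite_eq', Finset.sum_ite_eq']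
    -- The bracket sums over `1 ≤ m ≤ N - 1`; a term missing at an end would carry the factor `a_N`
    -- or `a_0`.
    have z1 : n + 1 ∉ Finset.Icc 1 (N - 1) → za x (n + 1 : ℕ) = 0 := fun h =>
      za_eq_zero _ (by simp at h; omega)
    have z2 : n ∉ Finset.Icc 1 (N - 1) → za x n = 0 := fun h =>
      za_eq_zero _ (by simp at h; omega)
    have c1 : ((n + 1 : ℕ) : ℤ) - 1 = n := by simp
    rw [c1]
    split_ifs with h1 h2 h2
    · push_cast; ring
    · rw [z2 h2]; push_cast; ring
    · rw [z1 h1]; push_cast; ring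
    · rw [z1 h1, z2 h2]; ring
  · rw [zb_eq_zero _ (by omega)]
    rcases (by omega : n < 1 ∨ (N : ℤ) + 1 ≤ n) with h | h
    · rw [za_eq_zero x (by omega), za_eq_zero x (n := n - 1) (by omega)]; ring
    · rw [za_eq_zero x (by omega), za_eq_zero x (n := n - 1) (by omega)]; ring

/-! ### Smoothness and derivatives of vector fields, component by component. -/

theorem contDiff_of_coord {V : Phase N → Phase N}
    (ha : ∀ n : ℤ, 1 ≤ n → n < N → ContDiff ℝ ∞ fun x => za (V x) n)
    (hb : ∀ n : ℤ, 1 ≤ n → n ≤ N → ContDiff ℝ ∞ fun x => zb (V x) n) : ContDiff ℝ ∞ V := by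
  have h1 : ContDiff ℝ ∞ fun x => (V x).1 := by
    refine contDiff_pi.2 fun i => ?_
    have h := ha (i.val + 1 : ℕ) (by omega) (by omega)
    simp only [za_natCast] at h
    simpa [ca, show i.val + 1 ≤ N - 1 by omega] using h
  have h2 : ContDiff ℝ ∞ fun x => (V x).2 := by
    refine contDiff_pi.2 fun i => ?_
    have h := hb (i.val + 1 : ℕ) (by omega) (by omega)
    simp only [zb_natCast] at h
    simpa [cb, show i.val + 1 ≤ N by omega] using h
  exact h1.prodMk h2

theorem contDiff_za (n : ℤ) : ContDiff ℝ ∞ fun x : Phase N => za x n := contDiff_ca _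

theorem contDiff_zb (n : ℤ) : ContDiff ℝ ∞ fun x : Phase N => zb x n := contDiff_cb _

/-- Taking a component is linear, so it commutes with the derivative; a component of `DV · v` can
then be computed by the product rule from any closed formula `g`. -/
theorem za_fderiv {V : Phase N → Phase N} {x v : Phase N} (hV : DifferentiableAt ℝ V x) {n : ℤ}
    {g : Phase N → ℝ} {f' : ℝ} (e : ∀ y, za (V y) n = g y) (h : HasLineDerivAt ℝ g f' x v) :
    za (fderiv ℝ V x v) n = f' := by
  obtain rfl : (fun y => za (V y) n) = g := funext e
  rw [← h.fderiv_real (((contDiff_za n).differentiable (by simp) _).comp x hV)]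
  have := fderiv_comp (𝕜 := ℝ) x ((contDiff_za n).differentiable (by simp) (V x)) hV
  change _ = fderiv ℝ ((fun x => za x n) ∘ V) x v
  rw [this]
  exact (fderiv_ca n.toNat (V x) _).symm

theorem zb_fderiv {V : Phase N → Phase N} {x v : Phase N} (hV : DifferentiableAt ℝ V x) {n : ℤ}
    {g : Phase N → ℝ} {f' : ℝ} (e : ∀ y, zb (V y) n = g y) (h : HasLineDerivAt ℝ g f' x v) :
    zb (fderiv ℝ V x v) n = f' := by
  obtain rfl : (fun y => zb (V y) n) = g := funext e
  rw [← h.fderiv_real (((contDiff_zb n).differentiable (by simp) _).comp x hV)]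
  have := fderiv_comp (𝕜 := ℝ) x ((contDiff_zb n).differentiable (by simp) (V x)) hV
  change _ = fderiv ℝ ((fun x => zb x n) ∘ V) x v
  rw [this]
  exact (fderiv_cb n.toNat (V x) _).symm

theorem contDiff_chi (k : ℕ) : ContDiff ℝ ∞ (chi N (k + 1)) := by
  refine contDiff_of_coord (fun n _ _ => ?_) (fun n _ _ => ?_)
  · simp only [za_chi]
    have := contDiff_ent_jacobi_pow (N := N) k
    have := contDiff_za (N := N)
    fun_prop
  · simp only [zb_chi]
    have := contDiff_ent_jacobi_pow (N := N) k
    have := contDiff_za (N := N)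
    fun_prop

/-! ### Brackets of a field in Lax form with `χ_{k+1}`. -/

/-- Leibniz rule: the commutator with `B` is a derivation, and each of the `k` factors contributes
one `ε L ^ (k + p)`. -/
theorem powDeriv_of_lax {x v : Phase N} {B : Matrix (Fin N) (Fin N) ℝ} {ε : ℝ} {p : ℕ}
    (h : jacobi v = B * jacobi x - jacobi x * B + ε • jacobi x ^ (p + 1)) (k : ℕ) :
    powDeriv x v k = B * jacobi x ^ k - jacobi x ^ k * B + (ε * k) • jacobi x ^ (k + p) := by
  induction k with
  | zero => simp [powDeriv]
  | succ k ih =>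
    have e : k + 1 + p = k + (p + 1) := by omega
    rw [powDeriv, ih, h, e]
    simp only [add_mul, sub_mul, mul_add, mul_sub, smul_mul_assoc, mul_smul_comm, ← pow_add,
      ← pow_succ, mul_assoc]
    simp only [← mul_assoc, ← pow_succ, add_assoc]
    push_cast
    rw [mul_add, add_smul, mul_one]
    abel

/-- In the derivative of `χ_{k+1}` along `X`, the factor `L ^ k` contributes `C + ε k L ^ (k + p)`,
and the second summand reassembles to `ε k χ_{k+1+p}`. The hypotheses `ha` and `hb` say that all
remaining terms are cancelled by the derivative of `X` along `χ_{k+1}`. -/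
theorem lieBracket_chi_of_lax {X : Phase N → Phase N} {x : Phase N}
    {B : Matrix (Fin N) (Fin N) ℝ} {ε : ℝ} {p k : ℕ}
    (hJ : jacobi (X x) = B * jacobi x - jacobi x * B + ε • jacobi x ^ (p + 1))
    {M C : ℤ → ℤ → ℝ} (hM : M = ent (jacobi x ^ k))
    (hC : C = ent (B * jacobi x ^ k - jacobi x ^ k * B))
    (ha : ∀ n : ℤ, 1 ≤ n → n < N → za (fderiv ℝ X x (chi N (k + 1) x)) n =
      za (X x) n * (M (n + 1) (n + 1) - M n n) + za x n * (C (n + 1) (n + 1) - C n n))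
    (hb : ∀ n : ℤ, 1 ≤ n → n ≤ N → zb (fderiv ℝ X x (chi N (k + 1) x)) n =
      2 * (za (X x) n * M n (n + 1) + za x n * C n (n + 1)
        - za (X x) (n - 1) * M (n - 1) n - za x (n - 1) * C (n - 1) n)) :
    VectorField.lieBracket ℝ X (chi N (k + 1)) x = (ε * k) • chi N (k + 1 + p) x := by
  have hχ : DifferentiableAt ℝ (chi N (k + 1)) x := (contDiff_chi k).differentiable (by simp) x
  have hza : ∀ (r : ℝ) (u v : Phase N) n, za (u - r • v) n = za u n - r * za v n := by
    intro r u v n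
    have := ca_add_smul u v (-r) n.toNat
    rw [neg_smul, ← sub_eq_add_neg, neg_mul, ← sub_eq_add_neg] at this
    exact this
  have hzb : ∀ (r : ℝ) (u v : Phase N) n, zb (u - r • v) n = zb u n - r * zb v n := by
    intro r u v n
    have := cb_add_smul u v (-r) n.toNat
    rw [neg_smul, ← sub_eq_add_neg, neg_mul, ← sub_eq_add_neg] at this
    exact this
  have hd : ∀ i j, ent (powDeriv x (X x) k) i j
      = C i j + ε * k * ent (jacobi x ^ (k + p)) i j := by
    intro i j
    rw [powDeriv_of_lax hJ, ent_add, ent_smul, hC]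
  rw [VectorField.lieBracket, sub_eq_iff_eq_add', ← sub_eq_iff_eq_add,
    show k + 1 + p = k + p + 1 by omega]
  refine phase_ext (fun n h1 h2 => ?_) (fun n h1 h2 => ?_)
  · rw [hza, ha n h1 h2, za_chi, hM]
    rw [za_fderiv hχ (za_chi k · n) ((hasLineDerivAt_za _ _ n).mul_real
      ((hasLineDerivAt_ent_jacobi_pow _ _ _ _ _).sub_real
        (hasLineDerivAt_ent_jacobi_pow _ _ _ _ _))), hd, hd]
    ring
  · rw [hzb, hb n h1 h2, zb_chi, hM]
    rw [zb_fderiv hχ (zb_chi k · n) ((((hasLineDerivAt_za _ _ n).mul_real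
      (hasLineDerivAt_ent_jacobi_pow _ _ _ _ _)).sub_real ((hasLineDerivAt_za _ _ (n - 1)).mul_real
        (hasLineDerivAt_ent_jacobi_pow _ _ _ _ _))).const_mul_real 2), hd, hd]
    ring

/-! ### Commutators with skew-symmetric band matrices; commutation of `L ^ k` with `L`. -/

/-- The pentadiagonal skew-symmetric matrix with entries `p_n` at `(n, n + 1)` and `q_n` at
`(n, n + 2)`. -/
def skewBand (N : ℕ) (p q : ℤ → ℝ) : Matrix (Fin N) (Fin N) ℝ :=
  (Matrix.of fun i j : Fin N => if i.val + 1 = j.val then p (i.val + 1)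
    else if i.val + 2 = j.val then q (i.val + 1) else 0)
  - (Matrix.of fun i j : Fin N => if i.val + 1 = j.val then p (i.val + 1)
    else if i.val + 2 = j.val then q (i.val + 1) else 0).transpose

theorem skewBand_transpose (p q : ℤ → ℝ) : (skewBand N p q).transpose = -skewBand N p q := by
  simp [skewBand]

/-- The vanishing of `p` and `q` off the matrix makes the formula valid for all integers `i ≤ j`. -/
theorem ent_skewBand {p q : ℤ → ℝ} (hp : ∀ i : ℤ, i < 1 ∨ N ≤ i → p i = 0)
    (hq : ∀ i : ℤ, i < 1 ∨ N ≤ i + 1 → q i = 0) (i j : ℤ) (hij : i ≤ j) :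
    ent (skewBand N p q) i j = if i + 1 = j then p i else if i + 2 = j then q i else 0 := by
  by_cases h : (1 ≤ i ∧ i ≤ N) ∧ 1 ≤ j ∧ j ≤ N
  · obtain ⟨i, rfl⟩ : ∃ i' : Fin N, i = i'.val + 1 := ⟨⟨(i - 1).toNat, by omega⟩, by simp; omega⟩
    obtain ⟨j, rfl⟩ : ∃ j' : Fin N, j = j'.val + 1 := ⟨⟨(j - 1).toNat, by omega⟩, by simp; omega⟩
    rw [ent_apply]
    simp only [skewBand, Matrix.sub_apply, Matrix.transpose_apply, Matrix.of_apply]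
    rw [if_neg (by omega : ¬j.val + 1 = i.val), if_neg (by omega : ¬j.val + 2 = i.val), sub_zero]
    grind
  · rw [ent_eq_zero _ h]
    split_ifs with h1 h2
    · rw [hp]; omega
    · rw [hq]; omega
    · rfl

theorem ent_skewBand_eq_zero {p q : ℤ → ℝ} (hp : ∀ i : ℤ, i < 1 ∨ N ≤ i → p i = 0)
    (hq : ∀ i : ℤ, i < 1 ∨ N ≤ i + 1 → q i = 0) (i j : ℤ) (hij : i + 2 < j ∨ j + 2 < i) :
    ent (skewBand N p q) i j = 0 := by
  rcases hij with h | h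
  · rw [ent_skewBand hp hq i j (by omega), if_neg (by omega), if_neg (by omega)]
  · have := ent_skewBand hp hq j i (by omega)
    rw [if_neg (by omega), if_neg (by omega), ← ent_transpose, skewBand_transpose,
      ← neg_one_smul ℝ, ent_smul] at this
    linarith

theorem ent_commutator_skewBand {p q : ℤ → ℝ} (hp : ∀ i : ℤ, i < 1 ∨ N ≤ i → p i = 0)
    (hq : ∀ i : ℤ, i < 1 ∨ N ≤ i + 1 → q i = 0)
    {M : Matrix (Fin N) (Fin N) ℝ} (hM : M.transpose = M) (i j : ℤ) :
    ent (skewBand N p q * M - M * skewBand N p q) i j =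
      p i * ent M (i + 1) j + q i * ent M (i + 2) j
      - p (i - 1) * ent M (i - 1) j - q (i - 2) * ent M (i - 2) j
      + p j * ent M i (j + 1) + q j * ent M i (j + 2)
      - p (j - 1) * ent M i (j - 1) - q (j - 2) * ent M i (j - 2) := by
  rw [ent_commutator (ent_skewBand_eq_zero hp hq) (skewBand_transpose p q) hM]
  have h1 : ∀ i, ent (skewBand N p q) i (i + 1) = p i := fun i => by
    rw [ent_skewBand hp hq _ _ (by omega), if_pos rfl]
  have h2 : ∀ i, ent (skewBand N p q) i (i + 2) = q i := fun i => by
    rw [ent_skewBand hp hq _ _ (by omega), if_neg (by omega), if_pos rfl]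
  have h3 : ∀ i, ent (skewBand N p q) (i - 1) i = p (i - 1) := fun i => by
    rw [ent_skewBand hp hq _ _ (by omega), if_pos (by omega)]
  have h4 : ∀ i, ent (skewBand N p q) (i - 2) i = q (i - 2) := fun i => by
    rw [ent_skewBand hp hq _ _ (by omega), if_neg (by omega), if_pos (by omega)]
  simp only [h1, h2, h3, h4]

theorem jacobi_eq_of_band {y : Phase N} {R : Matrix (Fin N) (Fin N) ℝ} (hR : R.transpose = R)
    (hb : ∀ n : ℤ, 1 ≤ n → n ≤ N → ent R n n = zb y n)
    (ha : ∀ n : ℤ, 1 ≤ n → n < N → ent R n (n + 1) = za y n)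
    (h0 : ∀ i j : ℤ, i + 2 ≤ j → ent R i j = 0) : jacobi y = R := by
  have key : ∀ i j : ℤ, i ≤ j → ent (jacobi y) i j = ent R i j := by
    intro i j hij
    by_cases h : (1 ≤ i ∧ i ≤ N) ∧ 1 ≤ j ∧ j ≤ N
    · rw [ent_jacobi]
      split_ifs with h1 h2 h3
      · rw [← h1, hb i (by omega) (by omega)]
      · rw [← h2, ha i (by omega) (by omega)]
      · omega
      · rw [h0 i j (by omega)]
    · rw [ent_eq_zero _ h, ent_eq_zero _ h]
  refine ent_ext fun i j => ?_
  rcases le_total i j with h | h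
  · exact key i j h
  · rw [← ent_transpose, jacobi_transpose, ← ent_transpose R, hR]
    exact key j i h

theorem ent_jacobi_pow_comm (x : Phase N) (k : ℕ) (i j : ℤ) :
    ent (jacobi x ^ k) i j = ent (jacobi x ^ k) j i := by
  rw [← ent_transpose, jacobi_pow_transpose]

/-- `L ^ k` commutes with `L`. -/
theorem ent_jacobi_pow_relation (x : Phase N) (k : ℕ) (i j : ℤ) :
    za x (i - 1) * ent (jacobi x ^ k) (i - 1) j + zb x i * ent (jacobi x ^ k) i j
      + za x i * ent (jacobi x ^ k) (i + 1) j =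
    za x (j - 1) * ent (jacobi x ^ k) i (j - 1) + zb x j * ent (jacobi x ^ k) i j
      + za x j * ent (jacobi x ^ k) i (j + 1) := by
  rw [← ent_jacobi_mul, ← ent_mul_jacobi, ← pow_succ, ← pow_succ']

/-- Normal forms for shifted indices, so that equal entries become the same atom for `ring` and
`linear_combination`. -/
theorem int_shift (n : ℤ) : n + 1 + 1 = n + 2 ∧ n - 1 - 1 = n - 2 ∧ n - 1 + 1 = n ∧ n + 1 - 1 = n ∧
    n + 2 - 1 = n + 1 ∧ n - 2 + 1 = n - 1 ∧ n + 1 - 2 = n - 1 ∧ n - 1 + 2 = n + 1 ∧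
    n + 2 - 2 = n ∧ n - 2 + 2 = n ∧ n + 1 + 2 = n + 3 ∧ n - 1 - 2 = n - 3 ∧ n + 2 + 1 = n + 3 ∧
    n - 2 - 1 = n - 3 ∧ n - 1 + 3 = n + 2 ∧ n - 2 + 3 = n + 1 ∧ n - 3 + 1 = n - 2 := by
  omega

/-! ### The Toda field and `X_1`: Lax forms and brackets. -/

theorem za_chi_two (x : Phase N) (n : ℤ) :
    za (chi N 2 x) n = za x n * (zb x (n + 1) - zb x n) := by
  rw [za_chi, pow_one, ent_jacobi, ent_jacobi, if_pos rfl, if_pos rfl]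

theorem zb_chi_two (x : Phase N) (n : ℤ) :
    zb (chi N 2 x) n = 2 * (za x n ^ 2 - za x (n - 1) ^ 2) := by
  rw [zb_chi, pow_one, ent_jacobi, ent_jacobi, if_neg (by omega), if_pos rfl, if_neg (by omega),
    if_pos (by omega)]
  ring

theorem todaField_eq_chi : todaField N = chi N 2 := by
  funext x
  refine phase_ext (fun n h1 h2 => ?_) (fun n h1 h2 => ?_)
  · obtain ⟨n, rfl⟩ := Int.eq_ofNat_of_zero_le (by omega : 0 ≤ n)
    rw [za_chi_two, za_natCast, ca, dif_pos (by omega)]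
    simp only [todaField, mkField]
    rw [Nat.sub_add_cancel (by omega), zb_natCast, ← zb_natCast _ (n + 1), za_natCast]
    push_cast
    rfl
  · obtain ⟨n, rfl⟩ : ∃ m : ℕ, n = (m + 1 : ℕ) := ⟨(n - 1).toNat, by omega⟩
    rw [zb_chi_two, zb_natCast, cb, dif_pos (by omega)]
    simp only [todaField, mkField, Nat.add_sub_cancel]
    rw [za_natCast, ← za_natCast _ n]
    push_cast
    rw [add_sub_cancel_right]

theorem commutator_skewBand_transpose (p q : ℤ → ℝ) {M : Matrix (Fin N) (Fin N) ℝ}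
    (hM : M.transpose = M) : (skewBand N p q * M - M * skewBand N p q).transpose
      = skewBand N p q * M - M * skewBand N p q := by
  simp only [Matrix.transpose_sub, Matrix.transpose_mul, hM, skewBand_transpose]
  simp only [mul_neg, neg_mul]
  abel

section Lax

variable (x : Phase N)

theorem ent_jacobi_diag (i : ℤ) : ent (jacobi x) i i = zb x i := by
  rw [ent_jacobi, if_pos rfl]

theorem ent_jacobi_add_one (i : ℤ) : ent (jacobi x) i (i + 1) = za x i := by
  rw [ent_jacobi, if_neg (by omega), if_pos rfl]

theorem ent_jacobi_sub_one (i : ℤ) : ent (jacobi x) (i - 1) i = za x (i - 1) := by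
  rw [ent_jacobi, if_neg (by omega), if_pos (by omega)]

theorem ent_jacobi_add_one' (i : ℤ) : ent (jacobi x) (i + 1) i = za x i := by
  rw [ent_jacobi, if_neg (by omega), if_neg (by omega), if_pos rfl]

theorem ent_jacobi_sub_one' (i : ℤ) : ent (jacobi x) i (i - 1) = za x (i - 1) := by
  rw [ent_jacobi, if_neg (by omega), if_neg (by omega), if_pos (by omega)]

theorem ent_jacobi_band {i j : ℤ} (h : i + 2 ≤ j ∨ j + 2 ≤ i) : ent (jacobi x) i j = 0 := by
  rw [ent_jacobi, if_neg (by omega), if_neg (by omega), if_neg (by omega)]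

variable {x}

/-- The commutator of `L` with a tridiagonal skew-symmetric matrix. -/
theorem ent_commutator_tri {β : ℤ → ℝ} (i j : ℤ) (hij : i ≤ j) :
    ent (skewBand N (fun n => β n * za x n) (fun _ => 0) * jacobi x
      - jacobi x * skewBand N (fun n => β n * za x n) (fun _ => 0)) i j =
      if i = j then 2 * (β i * za x i ^ 2 - β (i - 1) * za x (i - 1) ^ 2)
      else if i + 1 = j then β i * za x i * (zb x (i + 1) - zb x i)
      else if i + 2 = j then (β i - β (i + 1)) * za x i * za x (i + 1)
      else 0 := by
  rw [ent_commutator_skewBand (fun i h => by rw [za_eq_zero x h, mul_zero]) (fun _ _ => rfl)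
    (jacobi_transpose x)]
  split_ifs with h1 h2 h3
  · subst h1
    simp only [ent_jacobi_add_one, ent_jacobi_add_one', ent_jacobi_sub_one, ent_jacobi_sub_one']
    ring
  · subst h2
    simp only [int_shift, ent_jacobi_diag, add_sub_cancel_right,
      ent_jacobi_band x (i := i) (j := i + 2) (by omega),
      ent_jacobi_band x (i := i - 1) (j := i + 1) (by omega)]
    ring
  · subst h3
    rw [show i + 2 = i + 1 + 1 by ring, add_sub_cancel_right, ent_jacobi_add_one,
      ent_jacobi_add_one, ent_jacobi_band x (i := i) (by omega),
      ent_jacobi_band x (i := i - 1) (by omega)]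
    ring
  · rw [ent_jacobi_band x (i := i + 1) (by omega), ent_jacobi_band x (i := i - 1) (by omega),
      ent_jacobi_band x (j := j + 1) (by omega), ent_jacobi_band x (j := j - 1) (by omega)]
    ring

theorem jacobi_chi_two : jacobi (chi N 2 x) =
    skewBand N (za x) (fun _ => 0) * jacobi x - jacobi x * skewBand N (za x) (fun _ => 0)
      + (0 : ℝ) • jacobi x ^ (0 + 1) := by
  have h := ent_commutator_tri (x := x) (β := fun _ => 1)
  simp only [one_mul] at h
  rw [zero_smul, add_zero]
  refine jacobi_eq_of_band (commutator_skewBand_transpose _ _ (jacobi_transpose x))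
    (fun n _ _ => ?_) (fun n _ _ => ?_) (fun i j hij => ?_)
  · rw [h _ _ le_rfl, if_pos rfl, zb_chi_two]
  · rw [h _ _ (by omega), if_neg (by omega), if_pos rfl, za_chi_two]
  · rw [h _ _ (by omega), if_neg (by omega), if_neg (by omega)]
    split_ifs <;> ring

theorem za_masterOne (n : ℤ) : za (masterOne N x) n
    = za x n * (-n * zb x n + (n + 2) * zb x (n + 1)) := by
  by_cases hn : 1 ≤ n ∧ n < N
  · obtain ⟨n, rfl⟩ := Int.eq_ofNat_of_zero_le (by omega : 0 ≤ n)
    rw [za_natCast, ca, dif_pos (by omega)]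
    simp only [masterOne, mkField]
    rw [Nat.sub_add_cancel (by omega), zb_natCast, ← zb_natCast _ (n + 1), za_natCast]
    push_cast
    ring
  · rw [za_eq_zero _ (by omega), za_eq_zero _ (by omega), zero_mul]

theorem zb_masterOne {n : ℤ} (hn : 1 ≤ n ∧ n ≤ N) : zb (masterOne N x) n
    = (2 * n + 3) * za x n ^ 2 + (1 - 2 * n) * za x (n - 1) ^ 2 + zb x n ^ 2 := by
  obtain ⟨n, rfl⟩ : ∃ m : ℕ, n = (m + 1 : ℕ) := ⟨(n - 1).toNat, by omega⟩
  rw [zb_natCast, cb, dif_pos (by omega)]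
  simp only [masterOne, mkField, Nat.add_sub_cancel]
  rw [za_natCast, ← za_natCast _ n, zb_natCast]
  push_cast
  rw [add_sub_cancel_right]

/-- With `β_n = n + 1` the entry `(n, n+2)` of the commutator is `(β_n - β_{n+1}) a_n a_{n+1} = -a_n
a_{n+1}`, which cancels that of `L ^ 2`; this keeps the right-hand side tridiagonal. -/
theorem jacobi_masterOne : jacobi (masterOne N x) =
    skewBand N (fun n => (n + 1) * za x n) (fun _ => 0) * jacobi x
      - jacobi x * skewBand N (fun n => (n + 1) * za x n) (fun _ => 0)
      + (1 : ℝ) • jacobi x ^ (1 + 1) := by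
  have h := ent_commutator_tri (x := x) (β := fun n => n + 1)
  rw [one_smul]
  refine jacobi_eq_of_band ?_ (fun n h1 h2 => ?_) (fun n _ _ => ?_) (fun i j hij => ?_)
  · rw [Matrix.transpose_add, jacobi_pow_transpose,
      commutator_skewBand_transpose _ _ (jacobi_transpose x)]
  · rw [ent_add, h _ _ le_rfl, if_pos rfl, zb_masterOne ⟨h1, h2⟩, pow_two (jacobi x),
      ent_jacobi_mul,
      ent_jacobi_diag, ent_jacobi_add_one', ent_jacobi_sub_one]
    push_cast
    ring
  · rw [ent_add, h _ _ (by omega), if_neg (by omega), if_pos rfl, za_masterOne, pow_two,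
      ent_jacobi_mul, ent_jacobi_diag, ent_jacobi_add_one,
      ent_jacobi_band x (i := n - 1) (by omega)]
    ring
  · rw [ent_add, h _ _ (by omega), if_neg (by omega), if_neg (by omega), pow_two, ent_jacobi_mul,
      ent_jacobi_band x (i := i) (by omega), ent_jacobi_band x (i := i - 1) (by omega)]
    split_ifs with h3
    · subst h3
      rw [show i + 2 = i + 1 + 1 by ring, ent_jacobi_add_one]
      push_cast
      ring
    · rw [ent_jacobi_band x (by omega)]
      ring

theorem contDiff_masterOne : ContDiff ℝ ∞ (masterOne N) := by
  have := contDiff_za (N := N)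
  have := contDiff_zb (N := N)
  refine contDiff_of_coord (fun n _ _ => ?_) (fun n h1 h2 => ?_)
  · simp only [za_masterOne]; fun_prop
  · simp only [zb_masterOne ⟨h1, h2⟩]; fun_prop

/-- The entry `(n, n+1)` of `L · L ^ k = L ^ k · L`, solved for the difference of neighbouring
diagonal entries. -/
theorem ent_jacobi_pow_relation_one (k : ℕ) (n : ℤ) :
    za x n * (ent (jacobi x ^ k) (n + 1) (n + 1) - ent (jacobi x ^ k) n n) =
      (zb x (n + 1) - zb x n) * ent (jacobi x ^ k) n (n + 1)
      + za x (n + 1) * ent (jacobi x ^ k) n (n + 2)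
      - za x (n - 1) * ent (jacobi x ^ k) (n - 1) (n + 1) := by
  have h := ent_jacobi_pow_relation x k n (n + 1)
  simp only [int_shift] at h
  linear_combination h

/-- The entry `(n, n+2)` of the same identity, solved for the entries at distance three from the
diagonal. -/
theorem ent_jacobi_pow_relation_two (k : ℕ) (n : ℤ) :
    za x (n + 2) * ent (jacobi x ^ k) n (n + 3) - za x (n - 1) * ent (jacobi x ^ k) (n - 1) (n + 2)
      = za x n * ent (jacobi x ^ k) (n + 1) (n + 2) - za x (n + 1) * ent (jacobi x ^ k) n (n + 1)
        - (zb x (n + 2) - zb x n) * ent (jacobi x ^ k) n (n + 2) := by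
  have h := ent_jacobi_pow_relation x k n (n + 2)
  simp only [int_shift] at h
  linear_combination -h

theorem lieBracket_chi_two_chi (k : ℕ) :
    VectorField.lieBracket ℝ (chi N 2) (chi N (k + 1)) x = 0 := by
  have hd := (contDiff_chi (N := N) 1).differentiable (by simp) x
  have hz := fun i (h : i < 1 ∨ (N : ℤ) ≤ i) => za_eq_zero x h
  have h := lieBracket_chi_of_lax (k := k) (jacobi_chi_two (x := x)) rfl rfl
    (fun n _ _ => ?_) (fun n _ _ => ?_)
  · rw [h, zero_mul, zero_smul]
  · rw [za_fderiv hd (za_chi_two · n) ((hasLineDerivAt_za _ _ _).mul_real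
      ((hasLineDerivAt_zb _ _ _).sub_real (hasLineDerivAt_zb _ _ _)))]
    simp only [za_chi_two]
    simp only [ent_commutator_skewBand hz (fun _ _ => rfl) (jacobi_pow_transpose x k), za_chi,
      zb_chi, int_shift]
    rw [ent_jacobi_pow_comm x k n (n - 1), ent_jacobi_pow_comm x k (n + 1) n,
      ent_jacobi_pow_comm x k (n + 2) (n + 1)]
    ring
  · rw [zb_fderiv hd (fun y => (zb_chi_two y n).trans (by rw [pow_two, pow_two]))
      ((((hasLineDerivAt_za _ _ _).mul_real (hasLineDerivAt_za _ _ _)).sub_real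
      ((hasLineDerivAt_za _ _ _).mul_real (hasLineDerivAt_za _ _ _))).const_mul_real 2)]
    simp only [za_chi_two]
    simp only [ent_commutator_skewBand hz (fun _ _ => rfl) (jacobi_pow_transpose x k), za_chi,
      int_shift]
    have h0 := ent_jacobi_pow_relation_one (x := x) k n
    have h1 := ent_jacobi_pow_relation_one (x := x) k (n - 1)
    simp only [int_shift] at h1
    -- The coefficients are those of the surviving diagonal differences `a_n (M_{n+1,n+1} -
    -- M_{n,n})`: 4 from differentiating `2 a_n²`, minus 2 from the commutator.
    linear_combination 2 * za x n * h0 - 2 * za x (n - 1) * h1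

theorem lieBracket_masterOne_chi (k : ℕ) :
    VectorField.lieBracket ℝ (masterOne N) (chi N (k + 1)) x = (k : ℝ) • chi N (k + 2) x := by
  have hd := (contDiff_masterOne (N := N)).differentiable (by simp) x
  have hz := fun i (h : i < 1 ∨ (N : ℤ) ≤ i) =>
    show ((i : ℝ) + 1) * za x i = 0 by rw [za_eq_zero x h, mul_zero]
  have h := lieBracket_chi_of_lax (k := k) (jacobi_masterOne (x := x)) rfl rfl
    (fun n _ _ => ?_) (fun n h1 h2 => ?_)
  · rw [h, one_mul]
  · rw [za_fderiv hd (fun y => za_masterOne n) ((hasLineDerivAt_za _ _ _).mul_real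
      (((hasLineDerivAt_zb _ _ _).const_mul_real _).add_real
        ((hasLineDerivAt_zb _ _ _).const_mul_real _)))]
    simp only [za_masterOne]
    simp only [ent_commutator_skewBand hz (fun _ _ => rfl) (jacobi_pow_transpose x k), za_chi,
      zb_chi, int_shift]
    rw [ent_jacobi_pow_comm x k n (n - 1), ent_jacobi_pow_comm x k (n + 1) n,
      ent_jacobi_pow_comm x k (n + 2) (n + 1)]
    push_cast
    ring
  · rw [zb_fderiv hd (fun y => (zb_masterOne ⟨h1, h2⟩).trans (by rw [pow_two, pow_two, pow_two]))
      (((((hasLineDerivAt_za _ _ _).mul_real (hasLineDerivAt_za _ _ _)).const_mul_real _).add_real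
      (((hasLineDerivAt_za _ _ _).mul_real (hasLineDerivAt_za _ _ _)).const_mul_real _)).add_real
      ((hasLineDerivAt_zb _ _ _).mul_real (hasLineDerivAt_zb _ _ _)))]
    simp only [za_masterOne]
    simp only [ent_commutator_skewBand hz (fun _ _ => rfl) (jacobi_pow_transpose x k), za_chi,
      zb_chi, int_shift]
    have h0 := ent_jacobi_pow_relation_one (x := x) k n
    have h1 := ent_jacobi_pow_relation_one (x := x) k (n - 1)
    simp only [int_shift] at h1
    push_cast
    -- Again diagonal differences: `2 (2n+3) - 2 (n+1) = 2n + 4` at `n`, and `2 (1-2n) + 2n = 2 -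
    -- 2n` at `n - 1`.
    linear_combination (2 * n + 4) * za x n * h0 + (2 - 2 * n) * za x (n - 1) * h1

end Lax

/-! ### The Euler field `X_0`, with `B = 0`. -/

theorem masterZero_eq_id : masterZero N = id := by
  funext x
  refine Prod.ext (funext fun i => ?_) (funext fun i => ?_)
  · simp [masterZero, mkField, ca]
  · simp [masterZero, mkField, cb]

theorem lieBracket_masterZero_chi (k : ℕ) (x : Phase N) :
    VectorField.lieBracket ℝ (masterZero N) (chi N (k + 1)) x = (k : ℝ) • chi N (k + 1) x := by
  rw [masterZero_eq_id]
  have h := lieBracket_chi_of_lax (k := k) (X := id) (x := x) (B := 0) (ε := 1) (p := 0)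
    (by simp) rfl rfl (fun n _ _ => ?_) (fun n _ _ => ?_)
  · rw [h, one_mul]
  · simp [za_chi, ent_zero]
  · simp [zb_chi, ent_zero]

/-! ### The field `X_2`. -/

/-- The partial sum `b_1 + ⋯ + b_{n-1}`. -/
def partialTrace (x : Phase N) (n : ℤ) : ℝ := ∑ k ∈ Finset.Ico 1 n.toNat, cb x k

theorem partialTrace_add_one (x : Phase N) (n : ℤ) :
    partialTrace x (n + 1) = partialTrace x n + zb x n := by
  rcases lt_or_ge n 1 with h | h
  · rw [zb_eq_zero x (.inl h), partialTrace, partialTrace, Finset.Ico_eq_empty (by omega),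
      Finset.Ico_eq_empty (by omega)]
    simp
  · rw [partialTrace, partialTrace, show (n + 1).toNat = n.toNat + 1 by omega,
      Finset.sum_Ico_succ_top (by omega), zb]

/-- The `b`-components of `χ_{k+1}` telescope and `a_0 = 0`. Thus the nonlocal partial sums in `X_2`
have local derivatives along `χ_{k+1}`. -/
theorem partialTrace_chi (k : ℕ) (x : Phase N) (n : ℤ) : partialTrace (chi N (k + 1) x) n
    = 2 * (za x (n - 1) * ent (jacobi x ^ k) (n - 1) n) := by
  rcases le_or_gt n 1 with h | h
  · rw [za_eq_zero x (.inl (by omega)), partialTrace, Finset.Ico_eq_empty (by omega)]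
    simp
  · induction n, (show 1 ≤ n by omega) using Int.leInduction with
    | base => omega
    | succ n hn ih =>
      rw [partialTrace_add_one, zb_chi, add_sub_cancel_right]
      rcases hn.eq_or_lt with h1 | h1
      · subst h1
        simp [partialTrace, za_eq_zero x (n := 0)]
      · rw [ih h1]
        ring

theorem trace_jacobi (x : Phase N) : (jacobi x).trace = partialTrace x (N + 1) := by
  rw [partialTrace, Int.toNat_natCast_add_one, Finset.sum_Ico_eq_sum_range, Matrix.trace,
    Nat.add_sub_cancel, ← Fin.sum_univ_eq_sum_range]
  refine Finset.sum_congr rfl fun i _ => ?_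
  rw [Matrix.diag_apply, jacobi, Matrix.of_apply, if_pos rfl, add_comm]

/-- The ratio `B_{n,n+1} / a_n` for the matrix `B` defining `X_2`. -/
def betaTwo (c κ : ℝ) (x : Phase N) (n : ℤ) : ℝ :=
  (n + c) * (zb x n + zb x (n + 1)) + partialTrace x n + κ * partialTrace x (N + 1)

section

variable (c κ : ℝ) (x : Phase N)

theorem upperTwo_sub_transpose : upperTwo c κ x - (upperTwo c κ x).transpose =
    skewBand N (fun n => za x n * betaTwo c κ x n)
      (fun n => ((n + c) * za x n * za x (n + 1))) := by
  have hz : ∀ k : ℕ, ((k : ℤ) + 1).toNat = k + 1 := fun k => by omega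
  have hz' : ∀ k : ℕ, ((k : ℤ) + 1 + 1).toNat = k + 2 := fun k => by omega
  have h : upperTwo c κ x = Matrix.of fun i j : Fin N =>
      if i.val + 1 = j.val then za x (i.val + 1) * betaTwo c κ x (i.val + 1)
      else if i.val + 2 = j.val then
        (((i.val + 1 : ℤ) : ℝ) + c) * za x (i.val + 1) * za x (i.val + 1 + 1) else 0 := by
    ext i j
    simp only [upperTwo, Matrix.of_apply, betaTwo, trace_jacobi, partialTrace, za, zb, hz, hz']
    push_cast
    rfl
  rw [h]
  rfl

theorem ent_rhsTwo (i j : ℤ) : ent (rhsTwo c κ x) i j =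
    ent (skewBand N (fun n => za x n * betaTwo c κ x n)
      (fun n => ((n + c) * za x n * za x (n + 1))) * jacobi x
      - jacobi x * skewBand N (fun n => za x n * betaTwo c κ x n)
      (fun n => ((n + c) * za x n * za x (n + 1)))) i j + ent (jacobi x ^ 3) i j := by
  rw [rhsTwo, upperTwo_sub_transpose, ent_add]

theorem first_band_eq_zero (i : ℤ) (h : i < 1 ∨ (N : ℤ) ≤ i) :
    za x i * betaTwo c κ x i = 0 := by
  rw [za_eq_zero x h, zero_mul]

theorem second_band_eq_zero (i : ℤ) (h : i < 1 ∨ (N : ℤ) ≤ i + 1) :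
    (i + c) * za x i * za x (i + 1) = 0 := by
  rcases h with h | h
  · rw [za_eq_zero x (.inl h)]; ring
  · rw [za_eq_zero x (.inr h)]; ring

theorem za_masterTwo (n : ℤ) : za (masterTwo N c κ x) n =
    za x n * (betaTwo c κ x n * (zb x (n + 1) - zb x n)
      + (n + 1 + c) * (za x (n + 1) * za x (n + 1))
      - (n - 2 + c) * (za x (n - 1) * za x (n - 1)) + za x n * za x n + zb x n * zb x n
      + zb x n * zb x (n + 1) + zb x (n + 1) * zb x (n + 1)) := by
  rw [← ent_jacobi_add_one, jacobi_masterTwo, ent_rhsTwo,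
    ent_commutator_skewBand (first_band_eq_zero c κ x) (second_band_eq_zero c x)
      (jacobi_transpose x), pow_succ', pow_two]
  simp only [ent_jacobi_mul, int_shift, ent_jacobi_diag, ent_jacobi_add_one,
    ent_jacobi_sub_one']
  rw [show n + 2 = n + 1 + 1 by ring, ent_jacobi_add_one', ent_jacobi_band x (i := n - 1) (by omega),
    ent_jacobi_band x (i := n - 2) (by omega),
    ent_jacobi_band x (i := n) (j := n + 1 + 1) (by omega),
    ent_jacobi_band x (i := n) (j := n + 3) (by omega)]
  push_cast
  ring

theorem zb_masterTwo (n : ℤ) : zb (masterTwo N c κ x) n =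
    za x n * za x n * (2 * betaTwo c κ x n + 2 * zb x n + zb x (n + 1))
    - za x (n - 1) * za x (n - 1) * (2 * betaTwo c κ x (n - 1) - 2 * zb x n - zb x (n - 1))
    + zb x n * (zb x n * zb x n) := by
  rw [← ent_jacobi_diag, jacobi_masterTwo, ent_rhsTwo,
    ent_commutator_skewBand (first_band_eq_zero c κ x) (second_band_eq_zero c x)
      (jacobi_transpose x), pow_succ', pow_two]
  simp only [ent_jacobi_mul, int_shift, ent_jacobi_diag, ent_jacobi_add_one', ent_jacobi_add_one,
    ent_jacobi_sub_one', ent_jacobi_sub_one]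
  rw [ent_jacobi_band x (i := n - 2) (by omega), ent_jacobi_band x (i := n + 2) (by omega),
    ent_jacobi_band x (j := n + 2) (by omega), ent_jacobi_band x (j := n - 2) (by omega)]
  ring

theorem hasLineDerivAt_partialTrace (v : Phase N) (n : ℤ) :
    HasLineDerivAt ℝ (fun y => partialTrace y n) (partialTrace v n) x v :=
  HasLineDerivAt.sum_real fun _ _ => hasLineDerivAt_cb _ _ _

theorem hasLineDerivAt_betaTwo (v : Phase N) (n : ℤ) :
    HasLineDerivAt ℝ (fun y => betaTwo c κ y n) (betaTwo c κ v n) x v :=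
  ((((hasLineDerivAt_zb _ _ _).add_real (hasLineDerivAt_zb _ _ _)).const_mul_real _).add_real
    (hasLineDerivAt_partialTrace _ _ _)).add_real
    ((hasLineDerivAt_partialTrace _ _ _).const_mul_real _)

theorem contDiff_betaTwo (n : ℤ) : ContDiff ℝ ∞ fun y : Phase N => betaTwo c κ y n := by
  have := contDiff_zb (N := N)
  have : ∀ m : ℤ, ContDiff ℝ ∞ fun y : Phase N => partialTrace y m := fun m =>
    ContDiff.sum fun k _ => contDiff_cb k
  unfold betaTwo
  fun_prop

theorem contDiff_masterTwo : ContDiff ℝ ∞ (masterTwo N c κ) := by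
  have := contDiff_za (N := N)
  have := contDiff_zb (N := N)
  have := contDiff_betaTwo (N := N) c κ
  refine contDiff_of_coord (fun n _ _ => ?_) (fun n _ _ => ?_)
  · simp only [za_masterTwo]; fun_prop
  · simp only [zb_masterTwo]; fun_prop

theorem lieBracket_masterTwo_chi (k : ℕ) :
    VectorField.lieBracket ℝ (masterTwo N c κ) (chi N (k + 1)) x = (k : ℝ) • chi N (k + 3) x := by
  have hd := (contDiff_masterTwo (N := N) c κ).differentiable (by simp) x
  have hJ : jacobi (masterTwo N c κ x) = skewBand N (fun n => za x n * betaTwo c κ x n)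
      (fun n => ((n + c) * za x n * za x (n + 1))) * jacobi x
      - jacobi x * skewBand N (fun n => za x n * betaTwo c κ x n)
      (fun n => ((n + c) * za x n * za x (n + 1))) + (1 : ℝ) • jacobi x ^ (2 + 1) := by
    rw [jacobi_masterTwo, rhsTwo, upperTwo_sub_transpose, one_smul]
  -- The trace of `L` is conserved by `χ_{k+1}`, because `a_N = 0`; hence the term with `κ` is not
  -- differentiated and `κ` stays arbitrary.
  have hT : partialTrace (chi N (k + 1) x) (N + 1) = 0 := by
    rw [partialTrace_chi, add_sub_cancel_right, za_eq_zero x (.inr le_rfl)]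
    ring
  -- Besides the full trace, all partial sums are reduced to the one at `n - 1`.
  have hs : ∀ n, partialTrace x n = partialTrace x (n - 1) + zb x (n - 1) := fun n => by
    rw [← partialTrace_add_one, sub_add_cancel]
  have za' := hasLineDerivAt_za x (chi N (k + 1) x)
  have zb' := hasLineDerivAt_zb x (chi N (k + 1) x)
  have beta' := hasLineDerivAt_betaTwo c κ x (chi N (k + 1) x)
  have hC := ent_commutator_skewBand (first_band_eq_zero c κ x) (second_band_eq_zero c x)
    (jacobi_pow_transpose x k)
  have h := lieBracket_chi_of_lax (k := k) hJ rfl rfl (fun n _ _ => ?_) (fun n h1 h2 => ?_)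
  · rw [h, one_mul]
  · rw [za_fderiv hd (za_masterTwo c κ · n) ((za' n).mul_real
      ((((((((beta' n).mul_real ((zb' (n + 1)).sub_real (zb' n))).add_real
        (((za' (n + 1)).mul_real (za' (n + 1))).const_mul_real _)).sub_real
        (((za' (n - 1)).mul_real (za' (n - 1))).const_mul_real _)).add_real
        ((za' n).mul_real (za' n))).add_real ((zb' n).mul_real (zb' n))).add_real
        ((zb' n).mul_real (zb' (n + 1)))).add_real ((zb' (n + 1)).mul_real (zb' (n + 1)))))]
    simp only [za_masterTwo, hC]
    simp only [betaTwo, hT, partialTrace_chi, za_chi, zb_chi, int_shift]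
    rw [partialTrace_add_one x n, hs n, ent_jacobi_pow_comm x k n (n - 1),
      ent_jacobi_pow_comm x k (n + 1) n, ent_jacobi_pow_comm x k (n + 2) (n + 1),
      ent_jacobi_pow_comm x k n (n - 2), ent_jacobi_pow_comm x k (n + 1) (n - 1),
      ent_jacobi_pow_comm x k (n + 2) n, ent_jacobi_pow_comm x k (n + 3) (n + 1)]
    have h0 := ent_jacobi_pow_relation_one (x := x) k n
    have h1 := ent_jacobi_pow_relation_one (x := x) k (n + 1)
    have h2 := ent_jacobi_pow_relation_one (x := x) k (n - 1)
    simp only [int_shift] at h1 h2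
    push_cast
    -- One relation for each of `a_n²`, `a_{n+1}²`, `a_{n-1}²` in the `a`-component of `X_2`, whose
    -- derivatives produce the diagonal differences.
    linear_combination 2 * za x n ^ 2 * h0 + 2 * (n + 1 + c) * za x n * za x (n + 1) * h1
      - 2 * (n - 2 + c) * za x n * za x (n - 1) * h2
  · rw [zb_fderiv hd (zb_masterTwo c κ · n)
      (((((za' n).mul_real (za' n)).mul_real ((((beta' n).const_mul_real _).add_real
        ((zb' n).const_mul_real _)).add_real (zb' (n + 1)))).sub_real
        (((za' (n - 1)).mul_real (za' (n - 1))).mul_real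
        ((((beta' (n - 1)).const_mul_real _).sub_real
        ((zb' n).const_mul_real _)).sub_real (zb' (n - 1))))).add_real
        ((zb' n).mul_real ((zb' n).mul_real (zb' n))))]
    simp only [za_masterTwo, hC]
    simp only [betaTwo, hT, partialTrace_chi, za_chi, zb_chi, int_shift]
    rw [partialTrace_add_one x n, hs n, show partialTrace x (n - 2) = partialTrace x (n - 1)
      - zb x (n - 2) by have := partialTrace_add_one x (n - 2); simp only [int_shift] at this; linarith,
      ent_jacobi_pow_comm x k n (n - 1), ent_jacobi_pow_comm x k (n + 1) n,
      ent_jacobi_pow_comm x k (n + 2) (n + 1), ent_jacobi_pow_comm x k (n - 1) (n - 2)]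
    have h0 := ent_jacobi_pow_relation_one (x := x) k n
    have h1 := ent_jacobi_pow_relation_one (x := x) k (n - 1)
    have r0 := ent_jacobi_pow_relation_two (x := x) k n
    have r1 := ent_jacobi_pow_relation_two (x := x) k (n - 1)
    have r2 := ent_jacobi_pow_relation_two (x := x) k (n - 2)
    simp only [int_shift] at h1 r1 r2
    set S := partialTrace x (n - 1)
    set T := κ * partialTrace x (N + 1)
    push_cast
    -- `h0` and `h1` remove the diagonal differences; their long factors are `β_n + 2 b_n + b_{n+1}`
    -- and `β_{n-1} - 2 b_n - b_{n-1}` written out. The outermost entries `M_{n,n+3}` and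
    -- `M_{n-3,n}` force the coefficients of `r0` and `r2`; at the two inner entries at distance
    -- three these are off by one, which `r1` corrects.
    linear_combination 2 * za x n * (((n + c) * (zb x n + zb x (n + 1)) + S + zb x (n - 1) + T)
      + 2 * zb x n + zb x (n + 1)) * h0 - 2 * za x (n - 1)
      * ((n - 1 + c) * (zb x (n - 1) + zb x n) + S + T - 2 * zb x n - zb x (n - 1)) * h1
      - 2 * (n + 1 + c) * za x n * za x (n + 1) * r0 - 2 * za x (n - 1) * za x n * r1
      + 2 * (n - 3 + c) * za x (n - 2) * za x (n - 1) * r2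

end

/-! ### All `X_n`, `n ≥ 0`, by the Jacobi identity. -/

theorem contDiff_masterNat (c κ : ℝ) (n : ℕ) : ContDiff ℝ ∞ (masterNat N c κ n) := by
  induction n using Nat.strong_induction_on with
  | _ n ih =>
    match n with
    | 0 =>
      rw [masterNat, masterZero_eq_id]
      exact contDiff_id
    | 1 => exact contDiff_masterOne
    | 2 => exact contDiff_masterTwo c κ
    | n + 3 =>
      unfold masterNat
      exact ((ContDiff.lieBracket_vectorField (n := ∞) contDiff_masterOne
        (ih (n + 2) (by omega))) (by simp)).const_smul _

/-- In the step, the Jacobi identity for `X_1`, `X_{n+2}`, `χ_{k+1}` expresses `[[X_1, X_{n+2}],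
χ_{k+1}]` through known brackets. One of them is `[X_{n+2}, χ_{k+2}]`, so the induction must run
over all `k` even though only `k = 1` is needed in the end. -/
theorem lieBracket_masterNat_chi (c κ : ℝ) (n k : ℕ) (x : Phase N) :
    VectorField.lieBracket ℝ (masterNat N c κ n) (chi N (k + 1)) x
      = (k : ℝ) • chi N (k + 1 + n) x := by
  induction n using Nat.strong_induction_on generalizing k x with
  | _ n ih =>
    match n with
    | 0 => exact lieBracket_masterZero_chi k x
    | 1 => exact lieBracket_masterOne_chi k
    | 2 => exact lieBracket_masterTwo_chi c κ x k
    | n + 3 =>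
      have hX := contDiff_masterNat (N := N) c κ (n + 2)
      have hd : ∀ l, DifferentiableAt ℝ (chi N (l + 1)) x := fun l =>
        (contDiff_chi l).differentiable (by simp) x
      have hL := (ContDiff.lieBracket_vectorField (m := ∞) (n := ∞) (contDiff_masterOne (N := N)) hX
        (by simp)).differentiable (by simp) x
      have h := VectorField.leibniz_identity_lieBracket (𝕜 := ℝ) (n := ∞) (x := x)
        (by rw [minSmoothness_of_isRCLikeNormedField]; exact WithTop.coe_le_coe.2 le_top)
        (contDiff_masterOne (N := N)).contDiffAt hX.contDiffAt
        (contDiff_chi (N := N) k).contDiffAt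
      have e1 : VectorField.lieBracket ℝ (masterNat N c κ (n + 2)) (chi N (k + 1))
          = (k : ℝ) • chi N (k + 1 + (n + 2)) := funext (ih (n + 2) (by omega) k)
      have e2 : VectorField.lieBracket ℝ (masterOne N) (chi N (k + 1)) = (k : ℝ) • chi N (k + 2) :=
        funext fun y => lieBracket_masterOne_chi k
      rw [e1, e2, show k + 1 + (n + 2) = k + (n + 2) + 1 by omega,
        VectorField.lieBracket_const_smul_right (hd (k + (n + 2))),
        VectorField.lieBracket_const_smul_right (hd (k + 1)), ih (n + 2) (by omega) (k + 1),
        lieBracket_masterOne_chi] at h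
      have e3 : masterNat N c κ (n + 3) = (1 / ((n : ℝ) + 1)) •
          VectorField.lieBracket ℝ (masterOne N) (masterNat N c κ (n + 2)) := rfl
      rw [e3, VectorField.lieBracket_const_smul_left hL, ← sub_eq_iff_eq_add.2 h,
        show k + 1 + 1 + (n + 2) = k + 1 + (n + 3) by omega,
        show k + (n + 2) + 2 = k + 1 + (n + 3) by omega, smul_smul, smul_smul, ← sub_smul, smul_smul]
      -- The scalars: `k (k + n + 2) - k (k + 1) = k (n + 1)`, and `n + 1` is the normalisation of
      -- `X_{n+3}`.
      congr 1
      push_cast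
      field_simp
      ring

/-! ### The case `n = -1` and the conclusion. -/

/-- `tr L` is a Casimir: `L ^ 0 = 1` has a constant diagonal and no off-diagonal entries. -/
theorem chi_one (x : Phase N) : chi N 1 x = 0 := by
  refine phase_ext (fun n h1 h2 => ?_) (fun n h1 h2 => ?_)
  · rw [za_chi, pow_zero]
    have h : ∀ m : ℤ, 1 ≤ m → m ≤ N → ent (1 : Matrix (Fin N) (Fin N) ℝ) m m = 1 := by
      intro m h1 h2
      simp [ent, h1, h2]
    rw [h n (by omega) (by omega), h (n + 1) (by omega) (by omega)]
    simp [za, ca]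
  · rw [zb_chi, pow_zero]
    have h : ∀ m : ℤ, ent (1 : Matrix (Fin N) (Fin N) ℝ) m (m + 1) = 0 := by
      intro m
      unfold ent
      split_ifs
      · rw [Matrix.one_apply_ne]
        simp only [ne_eq, Fin.mk.injEq]
        omega
      · rfl
    have h' := h (n - 1)
    rw [sub_add_cancel] at h'
    rw [h n, h']
    simp [zb, cb]

theorem contDiff_masterNegOne : ContDiff ℝ ∞ (masterNegOne N) := contDiff_const

/-- The Toda field depends on `b` only through the differences `b_{n+1} - b_n`, so its derivative
along the common shift vanishes. -/
theorem lieBracket_chi_two_masterNegOne (x : Phase N) :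
    VectorField.lieBracket ℝ (chi N 2) (masterNegOne N) x = 0 := by
  have hd := (contDiff_chi (N := N) 1).differentiable (by simp) x
  have hb : ∀ n : ℤ, 1 ≤ n → n ≤ N → zb (masterNegOne N x) n = 1 := by
    intro n h1 h2
    simp only [zb, cb]
    rw [dif_pos (by omega)]
    rfl
  have ha : ∀ n : ℤ, za (masterNegOne N x) n = 0 := by
    intro n
    simp [za, ca, masterNegOne, mkField]
  have hz : fderiv ℝ (masterNegOne N) x = 0 := fderiv_const_apply _
  rw [VectorField.lieBracket, hz, zero_apply, zero_sub, neg_eq_zero]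
  refine phase_ext (fun n h1 h2 => ?_) (fun n h1 h2 => ?_)
  · rw [za_fderiv hd (za_chi_two · n) ((hasLineDerivAt_za _ _ _).mul_real
      ((hasLineDerivAt_zb _ _ _).sub_real (hasLineDerivAt_zb _ _ _))), ha, hb n h1 (by omega),
      hb (n + 1) (by omega) (by omega)]
    simp [za, ca]
  · rw [zb_fderiv hd (fun y => (zb_chi_two y n).trans (by rw [pow_two, pow_two]))
      ((((hasLineDerivAt_za _ _ _).mul_real (hasLineDerivAt_za _ _ _)).sub_real
      ((hasLineDerivAt_za _ _ _).mul_real (hasLineDerivAt_za _ _ _))).const_mul_real 2), ha, ha]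
    simp [zb, cb]

theorem contDiff_master (c κ : ℝ) (n : ℤ) : ContDiff ℝ ∞ (master N c κ n) := by
  unfold master
  split_ifs
  · exact contDiff_masterNegOne
  · exact contDiff_masterNat c κ _

/-- The vector fields `X_n` are master symmetries of the Toda lattice. -/
theorem lieBracket_chi_two_master (c κ : ℝ) {n : ℤ} (hn : -1 ≤ n) (x : Phase N) :
    VectorField.lieBracket ℝ (chi N 2) (master N c κ n) x = -chi N (n + 2).toNat x := by
  unfold master
  split_ifs with h
  · obtain rfl : n = -1 := by omega
    rw [lieBracket_chi_two_masterNegOne]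
    exact (neg_eq_zero.2 (chi_one x)).symm
  · rw [VectorField.lieBracket_swap, lieBracket_masterNat_chi c κ _ 1,
      Nat.cast_one, one_smul, show (n + 2).toNat = 1 + 1 + n.toNat by omega]

theorem isSymmetry_timeField (c κ : ℝ) {n : ℤ} (hn : -1 ≤ n) :
    IsSymmetry (chi N 2) (timeField N c κ n) := by
  obtain ⟨k, hk⟩ : ∃ k, (n + 2).toNat = k + 1 := ⟨(n + 1).toNat, by omega⟩
  have hX := contDiff_master (N := N) c κ n
  have hχ := contDiff_chi (N := N) k
  unfold IsSymmetry timeField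
  refine ⟨?_, fun t x => ?_⟩
  · rw [hk]
    exact (hX.comp contDiff_snd).add (contDiff_fst.smul (hχ.comp contDiff_snd))
  · have hd : deriv (fun s : ℝ => master N c κ n x + s • chi N (n + 2).toNat x) t
        = chi N (n + 2).toNat x := by
      simpa using (((hasDerivAt_id t).smul_const (chi N (n + 2).toNat x)).const_add
        (master N c κ n x)).deriv
    have hs : (fun x => master N c κ n x + t • chi N (k + 1) x)
        = master N c κ n + t • chi N (k + 1) := rfl
    rw [hd, hk, hs, VectorField.lieBracket_add_right (hX.differentiable (by simp) x)
      ((hχ.differentiable (by simp) x).const_smul t),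
      VectorField.lieBracket_const_smul_right (hχ.differentiable (by simp) x),
      lieBracket_chi_two_chi, lieBracket_chi_two_master c κ hn, hk]
    simp

end Toda

end

theorem theorem7 (N : ℕ) (c κ : ℝ) (n : ℤ) (hn : -1 ≤ n) :
    Toda.IsSymmetry (Toda.todaField N) (Toda.timeField N c κ n) ∧
      Toda.IsSymmetry (Toda.chi N 2) (Toda.timeField N c κ n) := by
  rw [Toda.todaField_eq_chi]
  exact ⟨Toda.isSymmetry_timeField c κ hn, Toda.isSymmetry_timeField c κ hn⟩
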